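/- Let $k$ be a field and let $Q$ be a simply laced quiver (no double arrows and no loops). Let $\Delta=(A,M)$ be a $Q$-set (with zero compositions): a $k$-algebra $A_x$ for each vertex $x$ and, for each arrow $a$ with source $s(a)$ and target $t(a)$, a nonzero $A_{t(a)}$-$A_{s(a)}$-bimodule $M_a$ (on which $k$ acts centrally). Let $\omega=a_m\cdots a_1$ be a path of length $m\ge 2$ from $s(\omega)=s(a_1)$ to $t(\omega)=t(a_m)$. Let $M_\omega=M_{a_m}\otimes_{A_{s(a_m)}}\cdots\otimes_{A_{s(a_2)}}M_{a_1}$, an $A_{t(\omega)}$-$A_{s(\omega)}$-bimodule, and use the same notation for the subpaths of $\omega$. Let $\Delta_\omega$ be the $A_{t(\omega)}$-$A_{s(\omega)}$-bimodule which is $A_{s(\omega)}$ if $s(\omega)=t(\omega)$, is $M_a$ if there is an arrow $a$ from $s(\omega)$ to $t(\omega)$, and is $0$ otherwise. A trajectory of duration $n$ over $\omega$ is a sequence $\tau=(t(a_m)^{p_{m+1}},a_m,s(a_m)^{p_m},\dots,a_1,s(a_1)^{p_1})$ with integers $p_i\ge 0$ and $m+\sum_i p_i=n$, where $x^p$ means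 that the vertex $x$ is repeated $p$ times; $T_n(\omega)$ is the set of these, and $$\tau_\Delta=A_{t(a_m)}^{\otimes p_{m+1}}\otimes_k M_{a_m}\otimes_k A_{s(a_m)}^{\otimes p_m}\otimes_k\cdots\otimes_k M_{a_1}\otimes_k A_{s(a_1)}^{\otimes p_1}.$$ Let $\mathsf H^n_\omega(\Delta)$ be the cohomology in degree $n$ of the complex with $n$-cochains $\bigoplus_{\tau\in T_n(\omega)}\mathrm{Hom}_k(\tau_\Delta,\Delta_\omega)$ and the Hochschild coboundary $$(df)(x_1\otimes\cdots\otimes x_{n+1})=x_1f(x_2\otimes\cdots\otimes x_{n+1})+\sum_{i=1}^{n}(-1)^if(x_1\otimes\cdots\otimes x_ix_{i+1}\otimes\cdots\otimes x_{n+1})+(-1)^{n+1}f(x_1\otimes\cdots\otimes x_n)x_{n+1}$$ for $x_1\otimes\cdots\otimes x_{n+1}\in\sigma_\Delta$, $\sigma\in T_{n+1}(\omega)$, where only those terms are kept in which $f$ is evaluated on $\tau_\Delta$ for some $\tau\in T_n(\omega)$ obtained from $\sigma$ by decreasing one waiting time $p_i$ by one. Suppose that $\omega$ is Tor-vanishing,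 that is, $\mathrm{Tor}_n^{A_{s(a_i)}}(M_{a_i},M_{a_{i-1}\cdots a_1})=0$ for $i=2,\dots,m$ and all $n>0$. Then, for all $r\ge 0$, there is an isomorphism of $k$-vector spaces $$\mathsf H^{m+r}_\omega(\Delta)\cong\mathrm{Ext}^r_{A_{t(\omega)}\text{-}A_{s(\omega)}}(M_\omega,\Delta_\omega),$$ where the right-hand side is $\mathrm{Ext}$ of bimodules, that is, of left modules over $A_{t(\omega)}\otimes_k A_{s(\omega)}^{\mathrm{op}}$. -/

import Mathlib

open CategoryTheory TensorProduct MulOpposite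

universe u v w

noncomputable section

namespace PathCohomology

/-! ### Bimodules, balanced tensor products and `Tor` -/

/-- A `B`-`A`-bimodule over the field `k`: a left `B`-module and right `A`-module (that is, a left
`Aᵐᵒᵖ`-module) for which the two actions commute and induce the same `k`-vector space structure. -/
structure KBimodule (k : Type u) [Field k] (B A : Type u) [Ring B] [Algebra k B]
    [Ring A] [Algebra k A] where
  carrier : Type u
  [addCommGroup : AddCommGroup carrier]
  [module : Module k carrier]
  [leftModule : Module B carrier]
  [rightModule : Module Aᵐᵒᵖ carrier]
  [left_tower : IsScalarTower k B carrier]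
  [right_tower : IsScalarTower k Aᵐᵒᵖ carrier]
  [left_right : SMulCommClass B Aᵐᵒᵖ carrier]

attribute [instance] KBimodule.addCommGroup KBimodule.module KBimodule.leftModule
  KBimodule.rightModule KBimodule.left_tower KBimodule.right_tower KBimodule.left_right

section Balanced

variable (k : Type u) [Field k] (B : Type u) [Ring B]

/-- The subspace of `M ⊗[k] N` spanned by the elements `m b ⊗ n - m ⊗ b n`. -/
def balancedRel (M N : Type u) [AddCommGroup M] [Module k M] [Module Bᵐᵒᵖ M]
    [AddCommGroup N] [Module k N] [Module B N] : Submodule k (M ⊗[k] N) :=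
  Submodule.span k {t | ∃ (m : M) (b : B) (n : N), t = (op b • m) ⊗ₜ[k] n - m ⊗ₜ[k] (b • n)}

/-- The tensor product `M ⊗_B N` of a right `B`-module `M` and a left `B`-module `N`, where `B` is
a (noncommutative) `k`-algebra. -/
abbrev BalTensor (M N : Type u) [AddCommGroup M] [Module k M] [Module Bᵐᵒᵖ M]
    [AddCommGroup N] [Module k N] [Module B N] : Type u :=
  (M ⊗[k] N) ⧸ balancedRel k B M N

variable {M M' N N' : Type u}
  [AddCommGroup M] [Module k M] [Module Bᵐᵒᵖ M] [AddCommGroup M'] [Module k M'] [Module Bᵐᵒᵖ M']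
  [AddCommGroup N] [Module k N] [Module B N] [AddCommGroup N'] [Module k N'] [Module B N']

/-- The class of `m ⊗ n` in `M ⊗_B N`. -/
def BalTensor.tmul (m : M) (n : N) : BalTensor k B M N :=
  (balancedRel k B M N).mkQ (m ⊗ₜ[k] n)

theorem BalTensor.ext {P : Type u} [AddCommGroup P] [Module k P]
    {f g : BalTensor k B M N →ₗ[k] P}
    (h : ∀ m n, f (BalTensor.tmul k B m n) = g (BalTensor.tmul k B m n)) : f = g := by
  apply Submodule.linearMap_qext
  apply TensorProduct.ext'
  exact h

/-- The map `f ⊗ g : M ⊗_B N → M' ⊗_B N'`. -/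
def BalTensor.map (f : M →ₗ[k] M') (g : N →ₗ[k] N')
    (hf : ∀ (b : B) (m : M), f (op b • m) = op b • f m)
    (hg : ∀ (b : B) (n : N), g (b • n) = b • g n) :
    BalTensor k B M N →ₗ[k] BalTensor k B M' N' :=
  Submodule.mapQ _ _ (TensorProduct.map f g) <| by
    rw [balancedRel, Submodule.span_le]
    rintro _ ⟨m, b, n, rfl⟩
    refine Submodule.subset_span ⟨f m, b, g n, ?_⟩
    simp [hf, hg]

@[simp] theorem BalTensor.map_tmul (f : M →ₗ[k] M') (g : N →ₗ[k] N')
    (hf : ∀ (b : B) (m : M), f (op b • m) = op b • f m)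
    (hg : ∀ (b : B) (n : N), g (b • n) = b • g n) (m : M) (n : N) :
    BalTensor.map k B f g hf hg (BalTensor.tmul k B m n) = BalTensor.tmul k B (f m) (g n) := rfl

theorem BalTensor.tmul_add (m : M) (n n' : N) :
    BalTensor.tmul k B m (n + n') = BalTensor.tmul k B m n + BalTensor.tmul k B m n' := by
  simp [BalTensor.tmul, TensorProduct.tmul_add]

theorem BalTensor.add_tmul (m m' : M) (n : N) :
    BalTensor.tmul k B (m + m') n = BalTensor.tmul k B m n + BalTensor.tmul k B m' n := by
  simp [BalTensor.tmul, TensorProduct.add_tmul]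

theorem BalTensor.smul_tmul (c : k) (m : M) (n : N) :
    BalTensor.tmul k B (c • m) n = c • BalTensor.tmul k B m n := rfl

theorem BalTensor.tmul_smul (c : k) (m : M) (n : N) :
    BalTensor.tmul k B m (c • n) = c • BalTensor.tmul k B m n := by
  simp [BalTensor.tmul]

variable [Algebra k B]

attribute [local instance] ModuleCat.moduleOfAlgebraModule
  ModuleCat.isScalarTower_of_algebra_moduleCat

/-- The functor `M ⊗_B -` from left `B`-modules to `k`-vector spaces, for a right
`B`-module `M`. -/
def tensorFunctor (M : Type u) [AddCommGroup M] [Module k M] [Module Bᵐᵒᵖ M] :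
    ModuleCat.{u} B ⥤ ModuleCat.{u} k where
  obj N := ModuleCat.of k (BalTensor k B M N)
  map {N N'} f := ModuleCat.ofHom <|
    BalTensor.map k B LinearMap.id (f.hom.restrictScalars k) (by simp) (by simp)
  map_id N := by
    ext : 1
    exact BalTensor.ext k B fun m n => rfl
  map_comp f g := by
    ext : 1
    exact BalTensor.ext k B fun m n => rfl

instance tensorFunctor_additive (M : Type u) [AddCommGroup M] [Module k M] [Module Bᵐᵒᵖ M] :
    (tensorFunctor k B M).Additive where
  map_add {N N' f g} := by
    ext : 1
    exact BalTensor.ext k B fun m n => BalTensor.tmul_add k B m _ _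

/-- `Tor_n^B(M, N)` for a right `B`-module `M` and a left `B`-module `N`: the `n`-th left derived
functor of `M ⊗_B -`, evaluated at `N`. -/
def TorModule (M N : Type u) [AddCommGroup M] [Module k M] [Module Bᵐᵒᵖ M]
    [AddCommGroup N] [Module B N] (n : ℕ) : ModuleCat.{u} k :=
  ((tensorFunctor k B M).leftDerived n).obj (ModuleCat.of B N)

end Balanced
/-! ### Operations on bimodules -/

namespace KBimodule

variable {k : Type u} [Field k] {C B A : Type u} [Ring C] [Algebra k C] [Ring B] [Algebra k B]
  [Ring A] [Algebra k A]

/-- A `k`-algebra as a bimodule over itself. -/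
def regular (k : Type u) [Field k] (A : Type u) [Ring A] [Algebra k A] : KBimodule k A A where
  carrier := A

/-- The zero bimodule. -/
def zero (k : Type u) [Field k] (B A : Type u) [Ring B] [Algebra k B] [Ring A] [Algebra k A] :
    KBimodule k B A where
  carrier := PUnit.{u + 1}

/-- The `B`-`A`-bimodule `X` as a left module over `B ⊗ Aᵒᵖ`. -/
def toModuleCat (X : KBimodule k B A) : ModuleCat.{u} (B ⊗[k] Aᵐᵒᵖ) :=
  letI : Module (B ⊗[k] Aᵐᵒᵖ) X.carrier := TensorProduct.Algebra.module
  ModuleCat.of (B ⊗[k] Aᵐᵒᵖ) X.carrier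

/-- The left action of `C` on `M ⊗_B N`, namely `c (m ⊗ n) = c m ⊗ n`. -/
def tensorLeft (M : KBimodule k C B) (N : KBimodule k B A) :
    C →ₐ[k] Module.End k (BalTensor k B M.carrier N.carrier) :=
  AlgHom.ofLinearMap
    { toFun := fun c => BalTensor.map k B (Algebra.lsmul k k M.carrier c) LinearMap.id
        (fun b m => smul_comm c (op b) m) (fun _ _ => rfl)
      map_add' := fun c c' => BalTensor.ext k B fun m n =>
        (congrArg (BalTensor.tmul k B · n) (add_smul c c' m)).trans
          (BalTensor.add_tmul k B (c • m) (c' • m) n)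
      map_smul' := fun r c => BalTensor.ext k B fun m n =>
        congrArg (BalTensor.tmul k B · n) (smul_assoc r c m) }
    (BalTensor.ext k B fun m n => congrArg (BalTensor.tmul k B · n) (one_smul C m))
    (fun c c' => BalTensor.ext k B fun m n =>
      congrArg (BalTensor.tmul k B · n) (mul_smul c c' m))

/-- The right action of `A` on `M ⊗_B N`, namely `(m ⊗ n) a = m ⊗ n a`. -/
def tensorRight (M : KBimodule k C B) (N : KBimodule k B A) :
    Aᵐᵒᵖ →ₐ[k] Module.End k (BalTensor k B M.carrier N.carrier) :=
  AlgHom.ofLinearMap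
    { toFun := fun a => BalTensor.map k B LinearMap.id (Algebra.lsmul k k N.carrier a)
        (fun _ _ => rfl) (fun b n => (smul_comm b a n).symm)
      map_add' := fun a a' => BalTensor.ext k B fun m n =>
        (congrArg (BalTensor.tmul k B m) (add_smul a a' n)).trans
          (BalTensor.tmul_add k B m (a • n) (a' • n))
      map_smul' := fun r a => BalTensor.ext k B fun m n =>
        (congrArg (BalTensor.tmul k B m) (smul_assoc r a n)).trans
          (BalTensor.tmul_smul k B r m (a • n)) }
    (BalTensor.ext k B fun m n => congrArg (BalTensor.tmul k B m) (one_smul Aᵐᵒᵖ n))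
    (fun a a' => BalTensor.ext k B fun m n =>
      congrArg (BalTensor.tmul k B m) (mul_smul a a' n))

/-- The `C`-`A`-bimodule `M ⊗_B N`. -/
def tensor (M : KBimodule k C B) (N : KBimodule k B A) : KBimodule k C A :=
  letI left : Module C (BalTensor k B M.carrier N.carrier) :=
    Module.compHom _ (tensorLeft M N).toRingHom
  letI right : Module Aᵐᵒᵖ (BalTensor k B M.carrier N.carrier) :=
    Module.compHom _ (tensorRight M N).toRingHom
  { carrier := BalTensor k B M.carrier N.carrier
    leftModule := left
    rightModule := right
    left_tower := ⟨fun r c t => LinearMap.congr_fun (map_smul (tensorLeft M N) r c) t⟩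
    right_tower := ⟨fun r a t => LinearMap.congr_fun (map_smul (tensorRight M N) r a) t⟩
    left_right := ⟨fun c a t => LinearMap.congr_fun
      (BalTensor.ext k B (f := tensorLeft M N c * tensorRight M N a)
        (g := tensorRight M N a * tensorLeft M N c) fun _ _ => rfl) t⟩ }

end KBimodule

/-! ### Quivers, `Q`-sets and trajectories -/

/-- A quiver is simply laced if it has neither double arrows nor loops. -/
def IsSimplyLaced (V : Type w) [Quiver.{v} V] : Prop :=
  (∀ x y : V, Subsingleton (x ⟶ y)) ∧ ∀ x : V, IsEmpty (x ⟶ x)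

/-- A `Q`-set `Δ = (A, M)`: an algebra `A x` for each vertex `x` and a nonzero
`A y`-`A x`-bimodule `M a` for each arrow `a` from `x` to `y`. All compositions `M_b ⊗ M_a → _z M_x`
of bimodules of arrows are zero, so that there is no further datum. -/
structure QSet (k : Type u) [Field k] (V : Type w) [Quiver.{v} V] where
  A : V → Type u
  [ring : ∀ x, Ring (A x)]
  [algebra : ∀ x, Algebra k (A x)]
  M : ∀ {x y : V}, (x ⟶ y) → KBimodule k (A y) (A x)
  nontrivial : ∀ {x y : V} (a : x ⟶ y), Nontrivial (M a).carrier

attribute [instance] QSet.ring QSet.algebra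

/-- The trajectories of duration `n` over a path `ω = a_m ⋯ a_1`: sequences of `n` concatenated
vertices and arrows with product `ω`. They are written from the target to the source, as
`t(a_m)^{p_{m+1}}, a_m, s(a_m)^{p_m}, …, a_1, s(a_1)^{p_1}`, so that `n = m + ∑ p_i`:
`wait τ` has one further entry `t(ω)` in front of `τ`, and `step τ a` has the arrow `a` in front
of `τ` (`ω.cons a` is the path `a ω`). -/
inductive Traj {V : Type w} [Quiver.{v} V] {x : V} :
    ∀ {y : V}, Quiver.Path x y → ℕ → Type (max v w)
  | nil : Traj Quiver.Path.nil 0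
  | wait {y : V} {ω : Quiver.Path x y} {n : ℕ} (τ : Traj ω n) : Traj ω (n + 1)
  | step {y z : V} {ω : Quiver.Path x y} {n : ℕ} (τ : Traj ω n) (a : y ⟶ z) :
      Traj (ω.cons a) (n + 1)

namespace QSet

variable {k : Type u} [Field k] {V : Type w} [Quiver.{v} V] (Δ : QSet k V)

/-- The `A y`-`A x`-bimodule `_y M_x`: it is `A x` if `x = y`, it is `M a` if there is an
arrow `a` from `x` to `y`, and it is zero otherwise. -/
def hom (x y : V) : KBimodule k (Δ.A y) (Δ.A x) :=
  open Classical in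
  if h : x = y then h ▸ KBimodule.regular k (Δ.A x)
  else if h : Nonempty (x ⟶ y) then Δ.M h.some
  else KBimodule.zero k (Δ.A y) (Δ.A x)

/-- The bimodule `M_ω = M_{a_m} ⊗ ⋯ ⊗ M_{a_1}` along the path `ω = a_m ⋯ a_1`, the tensor products
being over the algebras at the inner vertices. For the path of length zero at `x` it
is `A x`. -/
def pathBimodule {x : V} : ∀ {y : V}, Quiver.Path x y → KBimodule k (Δ.A y) (Δ.A x)
  | _, .nil => KBimodule.regular k (Δ.A x)
  | _, .cons .nil a => Δ.M a
  | _, .cons (.cons ω b) a => (Δ.M a).tensor (pathBimodule (.cons ω b))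

/-- `ω = a_m ⋯ a_1` is Tor-vanishing: `Tor_n(M_{a_i}, M_{a_{i-1} ⋯ a_1}) = 0`, over the
algebra `A_{s(a_i)}`, for all `2 ≤ i ≤ m` and all `n > 0`. -/
def TorVanishing {x : V} : ∀ {y : V}, Quiver.Path x y → Prop
  | _, .nil => True
  | _, .cons .nil _ => True
  | _, .cons (b := y) (.cons ω b) a => TorVanishing (.cons ω b) ∧ ∀ n : ℕ, 0 < n →
      Limits.IsZero
        (TorModule k (Δ.A y) (Δ.M a).carrier (Δ.pathBimodule (.cons ω b)).carrier n)

/-- The evaluation `τ_Δ` of a trajectory: the tensor product over `k` of the algebras and bimodules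
at the successive entries of `τ`. -/
def eval {x : V} : ∀ {y : V} {ω : Quiver.Path x y} {n : ℕ}, Traj ω n → ModuleCat.{u} k
  | _, _, _, .nil => ModuleCat.of k k
  | y, _, _, .wait τ => ModuleCat.of k (Δ.A y ⊗[k] eval τ)
  | _, _, _, .step τ a => ModuleCat.of k ((Δ.M a).carrier ⊗[k] eval τ)

/-- The `n`-cochains along `ω` with coefficients in `X`: families of `k`-linear
maps `f τ : τ_Δ → X` for `τ` a trajectory of duration `n` over `ω`. -/
abbrev Cochain {x y : V} (ω : Quiver.Path x y) (X : Type u) [AddCommGroup X] [Module k X]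
    (n : ℕ) : Type (max u v w) :=
  ∀ τ : Traj ω n, Δ.eval τ →ₗ[k] X

section Differential

variable {Δ} {x : V} {X : Type u} [AddCommGroup X] [Module k X]

/-- The linear map on `(wait τ)_Δ = A_{t(ω)} ⊗ τ_Δ` given by a bilinear map. -/
def liftWait {y : V} {ω : Quiver.Path x y} {n : ℕ} {τ : Traj ω n}
    (g : Δ.A y →ₗ[k] Δ.eval τ →ₗ[k] X) : Δ.eval τ.wait →ₗ[k] X :=
  TensorProduct.lift g

/-- The linear map on `(step τ a)_Δ = M_a ⊗ τ_Δ` given by a bilinear map. -/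
def liftStep {y z : V} {ω : Quiver.Path x y} {n : ℕ} {τ : Traj ω n} {a : y ⟶ z}
    (g : (Δ.M a).carrier →ₗ[k] Δ.eval τ →ₗ[k] X) : Δ.eval (τ.step a) →ₗ[k] X :=
  TensorProduct.lift g

/-- The tensor `b ⊗ s` in `(wait τ)_Δ = A_{t(ω)} ⊗ τ_Δ`, as a bilinear map. -/
def consWait {y : V} {ω : Quiver.Path x y} {n : ℕ} (τ : Traj ω n) :
    Δ.A y →ₗ[k] Δ.eval τ →ₗ[k] Δ.eval τ.wait :=
  TensorProduct.mk k (Δ.A y) (Δ.eval τ)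

/-- The tensor `m ⊗ s` in `(step τ a)_Δ = M_a ⊗ τ_Δ`, as a bilinear map. -/
def consStep {y z : V} {ω : Quiver.Path x y} {n : ℕ} (τ : Traj ω n) (a : y ⟶ z) :
    (Δ.M a).carrier →ₗ[k] Δ.eval τ →ₗ[k] Δ.eval (τ.step a) :=
  TensorProduct.mk k (Δ.M a).carrier (Δ.eval τ)

/-- For a cochain `f`, the cochain `τ ↦ (s ↦ (b ↦ f (b ⊗ s)))` where `b` is in `A_{t(ω)}`. -/
def headWait {y : V} {ω : Quiver.Path x y} {n : ℕ} (f : Δ.Cochain ω X (n + 1)) :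
    Δ.Cochain ω (Δ.A y →ₗ[k] X) n :=
  fun τ => ((consWait τ).compr₂ (f τ.wait)).flip

/-- For a cochain `f` along `a ω`, the cochain `τ ↦ (s ↦ (m ↦ f (m ⊗ s)))` along `ω`, where `m` is
in `M_a`. -/
def headStep {y z : V} {ω : Quiver.Path x y} {n : ℕ} {a : y ⟶ z}
    (f : Δ.Cochain (ω.cons a) X (n + 1)) : Δ.Cochain ω ((Δ.M a).carrier →ₗ[k] X) n :=
  fun τ => ((consStep τ a).compr₂ (f (τ.step a))).flip

/-- The right action of `B` on `X`, as the bilinear map `(p, b) ↦ p b`. -/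
def rightMul (k : Type u) [Field k] (B X : Type u) [Ring B] [Algebra k B] [AddCommGroup X]
    [Module k X] [Module Bᵐᵒᵖ X] [IsScalarTower k Bᵐᵒᵖ X] : X →ₗ[k] B →ₗ[k] X :=
  LinearMap.mk₂ k (fun p b => op b • p) (fun _ _ _ => smul_add _ _ _)
    (fun c p b => smul_comm (op b) c p) (fun p b b' => add_smul (op b) (op b') p)
    (fun c p b => smul_assoc c (op b) p)

/-- The bilinear map `(b, b' ⊗ t) ↦ b b' ⊗ t` on `A_{t(ω)} × (wait τ)_Δ`. -/
def mergeWaitWait {y : V} {ω : Quiver.Path x y} {n : ℕ} (τ : Traj ω n) :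
    Δ.A y →ₗ[k] Δ.eval τ.wait →ₗ[k] Δ.eval τ.wait :=
  LinearMap.rTensorHom (Δ.eval τ) ∘ₗ LinearMap.mul k (Δ.A y)

/-- The bilinear map `(b, m ⊗ t) ↦ b m ⊗ t` on `A_{t(a)} × (step τ a)_Δ`. -/
def mergeWaitStep {y z : V} {ω : Quiver.Path x y} {n : ℕ} (τ : Traj ω n) (a : y ⟶ z) :
    Δ.A z →ₗ[k] Δ.eval (τ.step a) →ₗ[k] Δ.eval (τ.step a) :=
  LinearMap.rTensorHom (Δ.eval τ) ∘ₗ (Algebra.lsmul k k (Δ.M a).carrier).toLinearMap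

/-- The bilinear map `(m, b ⊗ t) ↦ m b ⊗ t` on `M_a × (wait τ)_Δ`. -/
def mergeStepWait {y z : V} {ω : Quiver.Path x y} {n : ℕ} (τ : Traj ω n) (a : y ⟶ z) :
    (Δ.M a).carrier →ₗ[k] Δ.eval τ.wait →ₗ[k] Δ.eval (τ.step a) :=
  LinearMap.rTensorHom (Δ.eval τ) ∘ₗ rightMul k (Δ.A y) (Δ.M a).carrier

/-- The sum of the terms of the Hochschild coboundary `d f`, except for the first one,
`-f(x_1x_2 ⊗ x_3 ⊗ ⋯ ⊗ x_{n+1}) + ⋯ + (-1)^n f(x_1 ⊗ ⋯ ⊗ x_n x_{n+1})`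
`+ (-1)^(n+1) f(x_1 ⊗ ⋯ ⊗ x_n) x_{n+1}`,
on `x_1 ⊗ ⋯ ⊗ x_{n+1}` in `σ_Δ`, where `f` is extended by zero to trajectories over other paths and
the product of elements of two bimodules `M_b` and `M_a` is zero. It is computed by recursion:
for `n > 0` it is `-f(x_1x_2 ⊗ x_3 ⊗ ⋯)` minus the same sum for `f(x_1 ⊗ -)`
on `x_2 ⊗ ⋯ ⊗ x_{n+1}`, and for `n = 0` it is `-f(1) x_1`. -/
def tail : ∀ {y : V} {ω : Quiver.Path x y} {n : ℕ} (σ : Traj ω (n + 1)) {X : Type u}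
    [AddCommGroup X] [Module k X] [Module (Δ.A x)ᵐᵒᵖ X] [IsScalarTower k (Δ.A x)ᵐᵒᵖ X]
    (_ : Δ.Cochain ω X n), Δ.eval σ →ₗ[k] X
  | _, _, _, .wait .nil, X, _, _, _, _, f =>
      -liftWait ((rightMul k (Δ.A x) X).flip.compl₂ (f .nil))
  | _, _, _, .step .nil _, _, _, _, _, _, _ => 0
  | _, _, _, .wait (.wait τ), _, _, _, _, _, f =>
      -liftWait ((mergeWaitWait τ).compr₂ (f τ.wait)) -
        liftWait (tail τ.wait (headWait f)).flip
  | _, _, _, .wait (.step τ a), _, _, _, _, _, f =>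
      -liftWait ((mergeWaitStep τ a).compr₂ (f (τ.step a))) -
        liftWait (tail (τ.step a) (headWait f)).flip
  | _, _, _, .step (.wait τ) a, _, _, _, _, _, f =>
      -liftStep ((mergeStepWait τ a).compr₂ (f (τ.step a))) -
        liftStep (tail τ.wait (headStep f)).flip
  | _, _, _, .step (.step τ b) a, _, _, _, _, _, f =>
      -liftStep (tail (τ.step b) (headStep f)).flip

/-- The first term `x_1 f(x_2 ⊗ ⋯ ⊗ x_{n+1})` of the Hochschild coboundary on `σ_Δ`, where `ρ` is the
left action of `A_{t(ω)}` on `X`. It vanishes if `x_1` is in the bimodule of an arrow, since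
then `x_2 ⊗ ⋯ ⊗ x_{n+1}` belongs to a trajectory over another path. -/
def first : ∀ {y : V} {ω : Quiver.Path x y} {n : ℕ} (_ : Δ.A y →ₗ[k] X →ₗ[k] X)
    (σ : Traj ω (n + 1)) (_ : Δ.Cochain ω X n), Δ.eval σ →ₗ[k] X
  | _, _, _, ρ, .wait τ, f => liftWait (ρ.compl₂ (f τ))
  | _, _, _, _, .step _ _, _ => 0

section Lemmas

variable {y z : V} {ω : Quiver.Path x y} {n : ℕ}

theorem liftWait_cons {τ : Traj ω n} (g : Δ.A y →ₗ[k] Δ.eval τ →ₗ[k] X) (b : Δ.A y)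
    (s : Δ.eval τ) : liftWait g (consWait τ b s) = g b s := rfl

theorem liftStep_cons {τ : Traj ω n} {a : y ⟶ z}
    (g : (Δ.M a).carrier →ₗ[k] Δ.eval τ →ₗ[k] X) (m : (Δ.M a).carrier)
    (s : Δ.eval τ) : liftStep g (consStep τ a m s) = g m s := rfl

theorem ext_wait {τ : Traj ω n} {g h : Δ.eval τ.wait →ₗ[k] X}
    (H : ∀ b s, g (consWait τ b s) = h (consWait τ b s)) : g = h :=
  TensorProduct.ext' H

theorem ext_step {τ : Traj ω n} {a : y ⟶ z} {g h : Δ.eval (τ.step a) →ₗ[k] X}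
    (H : ∀ m s, g (consStep τ a m s) = h (consStep τ a m s)) : g = h :=
  TensorProduct.ext' H

theorem mergeWaitWait_cons (τ : Traj ω n) (b b' : Δ.A y) (s : Δ.eval τ) :
    mergeWaitWait τ b (consWait τ b' s) = consWait τ (b * b') s := rfl

theorem mergeWaitStep_cons (τ : Traj ω n) (a : y ⟶ z) (b : Δ.A z) (m : (Δ.M a).carrier)
    (s : Δ.eval τ) : mergeWaitStep τ a b (consStep τ a m s) = consStep τ a (b • m) s := rfl

theorem mergeStepWait_cons (τ : Traj ω n) (a : y ⟶ z) (b : Δ.A y) (m : (Δ.M a).carrier)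
    (s : Δ.eval τ) : mergeStepWait τ a m (consWait τ b s) = consStep τ a (op b • m) s := rfl

variable [Module (Δ.A x)ᵐᵒᵖ X] [IsScalarTower k (Δ.A x)ᵐᵒᵖ X]

theorem tail_wait_nil (f : Δ.Cochain Quiver.Path.nil X 0) (b : Δ.A x) (c : Δ.eval Traj.nil) :
    tail (Traj.wait Traj.nil) f (consWait .nil b c) = -(op b • f .nil c) := rfl

theorem tail_wait_wait (τ : Traj ω n) (f : Δ.Cochain ω X (n + 1)) (b : Δ.A y)
    (s : Δ.eval τ.wait) :
    tail τ.wait.wait f (consWait τ.wait b s) =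
      -f τ.wait (mergeWaitWait τ b s) - tail τ.wait (headWait f) s b := by
  rw [tail]; rfl

theorem tail_wait_step (τ : Traj ω n) (a : y ⟶ z) (f : Δ.Cochain (ω.cons a) X (n + 1))
    (b : Δ.A z) (s : Δ.eval (τ.step a)) :
    tail (τ.step a).wait f (consWait (τ.step a) b s) =
      -f (τ.step a) (mergeWaitStep τ a b s) - tail (τ.step a) (headWait f) s b := rfl

theorem tail_step_wait (τ : Traj ω n) (a : y ⟶ z) (f : Δ.Cochain (ω.cons a) X (n + 1))
    (m : (Δ.M a).carrier) (s : Δ.eval τ.wait) :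
    tail (τ.wait.step a) f (consStep τ.wait a m s) =
      -f (τ.step a) (mergeStepWait τ a m s) - tail τ.wait (headStep f) s m := by
  rw [tail]; rfl

theorem tail_step_step {u' : V} (τ : Traj ω n) (b : y ⟶ z) (a : z ⟶ u')
    (f : Δ.Cochain ((ω.cons b).cons a) X (n + 1))
    (m : (Δ.M a).carrier) (s : Δ.eval (τ.step b)) :
    tail ((τ.step b).step a) f (consStep (τ.step b) a m s) =
      -tail (τ.step b) (headStep f) s m := by
  rw [tail]; rfl

theorem tail_step_nil (a : x ⟶ z) (f : Δ.Cochain (Quiver.Path.nil.cons a) X 0) :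
    tail (Traj.nil.step a) f = 0 := by
  rw [tail]

/-- Naturality of `tail` in the coefficients. -/
theorem tail_comp : ∀ {y : V} {ω : Quiver.Path x y} {n : ℕ} (σ : Traj ω (n + 1)) {X Y : Type u}
    [AddCommGroup X] [Module k X] [Module (Δ.A x)ᵐᵒᵖ X] [IsScalarTower k (Δ.A x)ᵐᵒᵖ X]
    [AddCommGroup Y] [Module k Y] [Module (Δ.A x)ᵐᵒᵖ Y] [IsScalarTower k (Δ.A x)ᵐᵒᵖ Y]
    (l : X →ₗ[k] Y) (_ : ∀ (a : (Δ.A x)ᵐᵒᵖ) (p : X), l (a • p) = a • l p)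
    (f : Δ.Cochain ω X n), tail σ (fun τ => l ∘ₗ f τ) = l ∘ₗ tail σ f
  | _, _, _, .wait .nil, _, _, _, _, _, _, _, _, _, _, l, hl, f => by
      refine ext_wait fun b c => ?_
      simp only [LinearMap.comp_apply, tail_wait_nil, map_neg, hl]
  | _, _, _, .step .nil _, _, _, _, _, _, _, _, _, _, _, l, hl, f => by
      rw [tail_step_nil, tail_step_nil, LinearMap.comp_zero]
  | _, _, _, .wait (.wait τ), _, _, _, _, _, _, _, _, _, _, l, hl, f => by
      refine ext_wait fun b s => ?_
      have := tail_comp τ.wait (l.compRight k (M := Δ.A _))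
        (fun a p => LinearMap.ext fun b => hl a (p b)) (headWait f)
      have := LinearMap.congr_fun (LinearMap.congr_fun this s) b
      simp only [LinearMap.comp_apply, tail_wait_wait, map_sub, map_neg]
      exact congrArg _ this
  | _, _, _, .wait (.step τ a), _, _, _, _, _, _, _, _, _, _, l, hl, f => by
      refine ext_wait fun b s => ?_
      have := tail_comp (τ.step a) (l.compRight k (M := Δ.A _))
        (fun a p => LinearMap.ext fun b => hl a (p b)) (headWait f)
      have := LinearMap.congr_fun (LinearMap.congr_fun this s) b
      simp only [LinearMap.comp_apply, tail_wait_step, map_sub, map_neg]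
      exact congrArg _ this
  | _, _, _, .step (.wait τ) a, _, _, _, _, _, _, _, _, _, _, l, hl, f => by
      refine ext_step fun b s => ?_
      have := tail_comp τ.wait (l.compRight k (M := (Δ.M a).carrier))
        (fun a p => LinearMap.ext fun b => hl a (p b)) (headStep f)
      have := LinearMap.congr_fun (LinearMap.congr_fun this s) b
      simp only [LinearMap.comp_apply, tail_step_wait, map_sub, map_neg]
      exact congrArg _ this
  | _, _, _, .step (.step τ b) a, _, _, _, _, _, _, _, _, _, _, l, hl, f => by
      refine ext_step fun b s => ?_
      have := tail_comp (τ.step _) (l.compRight k (M := (Δ.M a).carrier))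
        (fun a p => LinearMap.ext fun b => hl a (p b)) (headStep f)
      have := LinearMap.congr_fun (LinearMap.congr_fun this s) b
      simp only [LinearMap.comp_apply, tail_step_step, map_neg]
      exact congrArg _ this

theorem tail_add (σ : Traj ω (n + 1)) (f g : Δ.Cochain ω X n) :
    tail σ (f + g) = tail σ f + tail σ g := by
  let F : Δ.Cochain ω (X × X) n := fun τ => (f τ).prod (g τ)
  have h₁ : tail σ f = LinearMap.fst k X X ∘ₗ tail σ F :=
    tail_comp σ (LinearMap.fst k X X) (fun _ _ => rfl) F
  have h₂ : tail σ g = LinearMap.snd k X X ∘ₗ tail σ F :=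
    tail_comp σ (LinearMap.snd k X X) (fun _ _ => rfl) F
  have h₃ : tail σ (f + g) = (LinearMap.fst k X X + LinearMap.snd k X X) ∘ₗ tail σ F :=
    tail_comp σ (LinearMap.fst k X X + LinearMap.snd k X X)
      (fun a p => (smul_add a p.1 p.2).symm) F
  rw [h₁, h₂, h₃, LinearMap.add_comp]

theorem tail_smul (σ : Traj ω (n + 1)) (c : k) (f : Δ.Cochain ω X n) :
    tail σ (c • f) = c • tail σ f :=
  tail_comp σ (c • LinearMap.id) (fun a p => smul_comm c a p) f

/-- The coboundary for an arbitrary left action `ρ` on the coefficients. -/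
def dAux (ρ : Δ.A y →ₗ[k] X →ₗ[k] X) : Δ.Cochain ω X n →ₗ[k] Δ.Cochain ω X (n + 1) where
  toFun f σ := first ρ σ f + tail σ f
  map_add' f g := by
    funext σ
    have h : first ρ σ (f + g) = first ρ σ f + first ρ σ g := by
      cases σ with
      | wait τ => exact ext_wait fun b s => map_add (ρ b) (f τ s) (g τ s)
      | step τ a => exact (add_zero 0).symm
    change first ρ σ (f + g) + tail σ (f + g) = first ρ σ f + tail σ f + (first ρ σ g + tail σ g)
    rw [h, tail_add]
    abel
  map_smul' c f := by
    funext σ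
    have h : first ρ σ (c • f) = c • first ρ σ f := by
      cases σ with
      | wait τ => exact ext_wait fun b s => map_smul (ρ b) c (f τ s)
      | step τ a => exact (smul_zero c).symm
    change first ρ σ (c • f) + tail σ (c • f) = c • (first ρ σ f + tail σ f)
    rw [h, tail_smul, smul_add]

/-- The action of `A_{t(ω)}` on `Hom_k(A_{t(ω)}, X)` by `(b φ)(b') = φ(b' b)`. -/
def rhoWait (X : Type u) [AddCommGroup X] [Module k X] (y : V) :
    Δ.A y →ₗ[k] (Δ.A y →ₗ[k] X) →ₗ[k] (Δ.A y →ₗ[k] X) :=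
  (LinearMap.llcomp k (Δ.A y) (Δ.A y) X).flip ∘ₗ (LinearMap.mul k (Δ.A y)).flip

/-- The action of `A_{s(a)}` on `Hom_k(M_a, X)` by `(b φ)(m) = φ(m b)`. -/
def rhoStep (X : Type u) [AddCommGroup X] [Module k X] (a : y ⟶ z) :
    Δ.A y →ₗ[k] ((Δ.M a).carrier →ₗ[k] X) →ₗ[k] ((Δ.M a).carrier →ₗ[k] X) :=
  (LinearMap.llcomp k (Δ.M a).carrier (Δ.M a).carrier X).flip ∘ₗ
    (rightMul k (Δ.A y) (Δ.M a).carrier).flip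

/-- For a cochain `f`, the cochain `τ ↦ (s ↦ (b ↦ f (b s)))` on the trajectories `τ` that begin with
an arrow, and zero on the others. -/
def headActAt : ∀ {y : V} {ω : Quiver.Path x y} {n : ℕ} (τ : Traj ω n) (_ : Δ.Cochain ω X n),
    Δ.eval τ →ₗ[k] Δ.A y →ₗ[k] X
  | _, _, _, .step τ a, f => ((mergeWaitStep τ a).compr₂ (f (τ.step a))).flip
  | _, _, _, .wait _, _ => 0
  | _, _, _, .nil, _ => 0

/-- The cochain with values `headActAt`. -/
def headAct (f : Δ.Cochain ω X n) : Δ.Cochain ω (Δ.A y →ₗ[k] X) n :=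
  fun τ => headActAt τ f

theorem dAux_wait_nil (ρ : Δ.A x →ₗ[k] X →ₗ[k] X) (f : Δ.Cochain Quiver.Path.nil X 0)
    (b : Δ.A x) (c : Δ.eval Traj.nil) :
    dAux ρ f (Traj.wait Traj.nil) (consWait .nil b c) = ρ b (f .nil c) - op b • f .nil c :=
  (sub_eq_add_neg _ _).symm

theorem dAux_step_nil (a : x ⟶ z) (ρ : Δ.A z →ₗ[k] X →ₗ[k] X)
    (f : Δ.Cochain (Quiver.Path.nil.cons a) X 0) : dAux ρ f (Traj.nil.step a) = 0 :=
  add_zero 0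

theorem dAux_wait (ρ : Δ.A y →ₗ[k] X →ₗ[k] X) (f : Δ.Cochain ω X (n + 1)) (σ : Traj ω (n + 1))
    (b : Δ.A y) (s : Δ.eval σ) :
    dAux ρ f σ.wait (consWait σ b s) =
      ρ b (f σ s) - headAct f σ s b - dAux (rhoWait X y) (headWait f) σ s b := by
  cases σ with
  | wait τ =>
    change ρ b (f τ.wait s) + tail τ.wait.wait f (consWait τ.wait b s) = ρ b (f τ.wait s) - 0 -
      (first (rhoWait X y) τ.wait (headWait f) s b + tail τ.wait (headWait f) s b)
    have : first (rhoWait X y) τ.wait (headWait f) s b = f τ.wait (mergeWaitWait τ b s) := by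
      have : (first (rhoWait X y) τ.wait (headWait f)).flip b = f τ.wait ∘ₗ mergeWaitWait τ b :=
        ext_wait fun b' s => rfl
      exact LinearMap.congr_fun this s
    rw [tail_wait_wait, this]
    abel
  | step τ a =>
    change ρ b (f (τ.step a) s) + tail (τ.step a).wait f (consWait (τ.step a) b s) =
      ρ b (f (τ.step a) s) - f (τ.step a) (mergeWaitStep τ a b s) -
      (0 + tail (τ.step a) (headWait f) s b)
    rw [tail_wait_step]
    abel

theorem dAux_step (a : y ⟶ z) (ρ : Δ.A z →ₗ[k] X →ₗ[k] X) (f : Δ.Cochain (ω.cons a) X (n + 1))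
    (σ : Traj ω (n + 1)) (m : (Δ.M a).carrier) (s : Δ.eval σ) :
    dAux ρ f (σ.step a) (consStep σ a m s) = -dAux (rhoStep X a) (headStep f) σ s m := by
  cases σ with
  | wait τ =>
    change 0 + tail (τ.wait.step a) f (consStep τ.wait a m s) =
      -(first (rhoStep X a) τ.wait (headStep f) s m + tail τ.wait (headStep f) s m)
    have : first (rhoStep X a) τ.wait (headStep f) s m =
        f (τ.step a) (mergeStepWait τ a m s) := by
      have : (first (rhoStep X a) τ.wait (headStep f)).flip m =
          f (τ.step a) ∘ₗ mergeStepWait τ a m := ext_wait fun b' s => rfl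
      exact LinearMap.congr_fun this s
    rw [tail_step_wait, this]
    abel
  | step τ b =>
    change 0 + tail ((τ.step b).step a) f (consStep (τ.step b) a m s) =
      -(0 + tail (τ.step b) (headStep f) s m)
    rw [tail_step_step, zero_add, zero_add]

theorem dAux_comp {Y : Type u} [AddCommGroup Y] [Module k Y] [Module (Δ.A x)ᵐᵒᵖ Y]
    [IsScalarTower k (Δ.A x)ᵐᵒᵖ Y] (ρ : Δ.A y →ₗ[k] X →ₗ[k] X) (ρ' : Δ.A y →ₗ[k] Y →ₗ[k] Y)
    (l : X →ₗ[k] Y) (hl : ∀ (a : (Δ.A x)ᵐᵒᵖ) (p : X), l (a • p) = a • l p)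
    (hρ : ∀ (b : Δ.A y) (p : X), l (ρ b p) = ρ' b (l p)) (f : Δ.Cochain ω X n)
    (σ : Traj ω (n + 1)) : dAux ρ' (fun τ => l ∘ₗ f τ) σ = l ∘ₗ dAux ρ f σ := by
  change first ρ' σ (fun τ => l ∘ₗ f τ) + tail σ (fun τ => l ∘ₗ f τ) =
    l ∘ₗ (first ρ σ f + tail σ f)
  rw [tail_comp σ l hl, LinearMap.comp_add]
  congr 1
  cases σ with
  | wait τ => exact ext_wait fun b s => (hρ b (f τ s)).symm
  | step τ a => exact (LinearMap.comp_zero l).symm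

theorem headAct_apply_headAct (f : Δ.Cochain ω X n) (σ : Traj ω n) (s : Δ.eval σ)
    (b b' : Δ.A y) : headAct (headAct f) σ s b b' = headAct f σ s (b' * b) := by
  cases σ with
  | nil => rfl
  | wait τ => rfl
  | step τ a =>
    have : f (τ.step a) ∘ₗ mergeWaitStep τ a b' ∘ₗ mergeWaitStep τ a b =
        f (τ.step a) ∘ₗ mergeWaitStep τ a (b' * b) := by
      refine ext_step fun m t => ?_
      simp only [LinearMap.comp_apply, mergeWaitStep_cons, mul_smul]
    exact LinearMap.congr_fun this s

theorem dAux_headAct (ρ : Δ.A y →ₗ[k] X →ₗ[k] X) (f : Δ.Cochain ω X n) (σ : Traj ω (n + 1)) :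
    dAux (rhoWait X y) (headAct f) σ = headAct (dAux ρ f) σ := by
  cases σ with
  | wait σ =>
    cases n with
    | zero =>
      cases σ with
      | nil =>
        refine ext_wait fun b c => ?_
        rw [dAux_wait_nil]
        change rhoWait X x b 0 - op b • (0 : Δ.A x →ₗ[k] X) = 0
        rw [map_zero, smul_zero, sub_zero]
    | succ n =>
      refine ext_wait fun b s => LinearMap.ext fun b' => ?_
      have h : headWait (headAct f) = 0 := by
        funext τ
        exact LinearMap.ext fun s => LinearMap.ext fun b => rfl
      rw [dAux_wait, h, map_zero]
      change headAct f σ s (b' * b) - headAct (headAct f) σ s b b' - 0 = 0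
      rw [headAct_apply_headAct, sub_self, sub_zero]
  | step σ a =>
    cases n with
    | zero =>
      cases σ with
      | nil =>
        change dAux (rhoWait X _) (headAct f) (Traj.nil.step a) =
          ((mergeWaitStep Traj.nil a).compr₂ (dAux ρ f (Traj.nil.step a))).flip
        rw [dAux_step_nil, dAux_step_nil]
        rfl
    | succ n =>
      refine ext_step fun m s => LinearMap.ext fun b => ?_
      rw [dAux_step]
      let l : ((Δ.M a).carrier →ₗ[k] X) →ₗ[k] (Δ.M a).carrier →ₗ[k] Δ.A y →ₗ[k] X :=
        LinearMap.mk₂ k (fun φ m => φ ∘ₗ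
            ((Algebra.lsmul k k (A := Δ.A y) (Δ.M a).carrier).toLinearMap.flip m))
          (fun _ _ _ => rfl) (fun _ _ _ => rfl)
          (fun φ m m' => by rw [map_add, LinearMap.comp_add])
          (fun c φ m => by rw [map_smul, LinearMap.comp_smul])
      have h := dAux_comp (rhoStep X a) (rhoStep (Δ.A _ →ₗ[k] X) a) l
        (fun _ _ => rfl)
        (fun b' φ => LinearMap.ext fun m => LinearMap.ext fun b =>
          congrArg φ (smul_comm b (op b') m).symm) (headStep f) σ
      have h' := LinearMap.congr_fun (LinearMap.congr_fun (LinearMap.congr_fun h s) m) b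
      exact (congrArg Neg.neg h').trans (dAux_step a ρ f σ (b • m) s).symm

theorem dAux_dAux : ∀ {y : V} {ω : Quiver.Path x y} {n : ℕ} (σ : Traj ω (n + 2)) {X : Type u}
    [AddCommGroup X] [Module k X] [Module (Δ.A x)ᵐᵒᵖ X] [IsScalarTower k (Δ.A x)ᵐᵒᵖ X]
    (ρ : Δ.A y →ₗ[k] X →ₗ[k] X) (_ : ∀ b b' p, ρ (b * b') p = ρ b (ρ b' p))
    (_ : ∀ b (a : (Δ.A x)ᵐᵒᵖ) p, ρ b (a • p) = a • ρ b p)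
    (f : Δ.Cochain ω X n), dAux ρ (dAux ρ f) σ = 0
  | _, _, 0, .wait (.wait .nil), X, _, _, _, _, ρ, hρ, hρ', f => by
      refine ext_wait fun b s => ?_
      suffices H : dAux ρ (dAux ρ f) Traj.nil.wait.wait ∘ₗ consWait Traj.nil.wait b = 0 from
        LinearMap.congr_fun H s
      refine ext_wait fun b' c => ?_
      have h : headAct (dAux ρ f) Traj.nil.wait (consWait .nil b' c) b = 0 := rfl
      have h' : rhoWait X _ b' (headWait (dAux ρ f) .nil c) b =
          dAux ρ f Traj.nil.wait (consWait .nil (b * b') c) := rfl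
      have h'' : (op b' • headWait (dAux ρ f) .nil c) b =
          op b' • dAux ρ f Traj.nil.wait (consWait .nil b c) := rfl
      rw [LinearMap.comp_apply, dAux_wait, h, dAux_wait_nil, dAux_wait_nil, LinearMap.sub_apply,
        h', h'', dAux_wait_nil, dAux_wait_nil, map_sub, hρ, hρ', smul_sub, op_mul, mul_smul,
        LinearMap.zero_apply]
      abel
  | _, _, 0, .wait (.step .nil a), X, _, _, _, _, ρ, hρ, hρ', f => by
      refine ext_wait fun b s => ?_
      have h : headAct (dAux ρ f) (Traj.nil.step a) s b =
          dAux ρ f (Traj.nil.step a) (mergeWaitStep .nil a b s) := rfl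
      rw [dAux_wait, dAux_step_nil, h, dAux_step_nil, dAux_step_nil]
      simp
  | _, _, n + 1, .wait σ, X, _, _, _, _, ρ, hρ, hρ', f => by
      refine ext_wait fun b s => ?_
      have hw : headWait (dAux ρ f) = (fun τ => ρ.flip ∘ₗ f τ) - headAct f -
          dAux (rhoWait X _) (headWait f) := by
        funext τ
        exact LinearMap.ext fun s => LinearMap.ext fun b => dAux_wait ρ f τ b s
      have h₁ := dAux_comp ρ (rhoWait X _) ρ.flip
        (fun a p => LinearMap.ext fun b => hρ' b a p)
        (fun b p => LinearMap.ext fun b' => (hρ b' b p).symm) f σ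
      have h₂ := dAux_dAux σ (rhoWait X _)
        (fun b b' p => LinearMap.ext fun c => congrArg p (mul_assoc c b b').symm)
        (fun _ _ _ => rfl) (headWait f)
      rw [dAux_wait, hw, map_sub, map_sub, Pi.sub_apply, Pi.sub_apply, h₁, h₂, dAux_headAct ρ]
      simp
  | _, _, 0, .step σ a, X, _, _, _, _, ρ, hρ, hρ', f => by
      refine ext_step fun m s => ?_
      have h : headStep (dAux ρ f) = 0 := by
        funext τ
        cases τ with
        | nil =>
          change ((consStep Traj.nil a).compr₂ (dAux ρ f (Traj.nil.step a))).flip = 0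
          rw [dAux_step_nil]
          rfl
      rw [dAux_step, h, map_zero]
      simp
  | _, _, n + 1, .step σ a, X, _, _, _, _, ρ, hρ, hρ', f => by
      refine ext_step fun m s => ?_
      have hs : headStep (dAux ρ f) = - dAux (rhoStep X a) (headStep f) := by
        funext τ
        exact LinearMap.ext fun s => LinearMap.ext fun m => dAux_step a ρ f τ m s
      have h₂ := dAux_dAux σ (rhoStep X a)
        (fun b b' p => LinearMap.ext fun c => congrArg p (mul_smul (op b') (op b) c))
        (fun _ _ _ => rfl) (headStep f)
      rw [dAux_step, hs, map_neg, Pi.neg_apply, h₂]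
      simp

end Lemmas

end Differential

/-- The coboundary of cochains along `ω` with coefficients in the bimodule `X`, namely
`(d f)(x_1 ⊗ ⋯ ⊗ x_{n+1}) = x_1 f(x_2 ⊗ ⋯ ⊗ x_{n+1})`
`+ ∑ (-1)^i f(x_1 ⊗ ⋯ ⊗ x_i x_{i+1} ⊗ ⋯ ⊗ x_{n+1}) + (-1)^(n+1) f(x_1 ⊗ ⋯ ⊗ x_n) x_{n+1}`
on `σ_Δ`, where only those terms occur for which `f` is evaluated on a trajectory over `ω`; the
trajectory `σ` is then obtained from that one by increasing one waiting time. -/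
def d {x y : V} (ω : Quiver.Path x y) (X : KBimodule k (Δ.A y) (Δ.A x)) (n : ℕ) :
    Δ.Cochain ω X.carrier n →ₗ[k] Δ.Cochain ω X.carrier (n + 1) :=
  dAux (Algebra.lsmul k k X.carrier).toLinearMap

theorem d_comp_d {x y : V} (ω : Quiver.Path x y) (X : KBimodule k (Δ.A y) (Δ.A x)) (n : ℕ) :
    Δ.d ω X (n + 1) ∘ₗ Δ.d ω X n = 0 :=
  LinearMap.ext fun f => funext fun σ => dAux_dAux σ (Algebra.lsmul k k X.carrier).toLinearMap
    (fun b b' p => mul_smul b b' p) (fun b a p => smul_comm b a p) f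

/-- The complex of cochains along `ω` with coefficients in the bimodule `X`. -/
def complex {x y : V} (ω : Quiver.Path x y) (X : KBimodule k (Δ.A y) (Δ.A x)) :
    CochainComplex (ModuleCat.{max u v w} k) ℕ :=
  CochainComplex.of (fun n => ModuleCat.of k (Δ.Cochain ω X.carrier n))
    (fun n => ModuleCat.ofHom (Δ.d ω X n))
    (fun n => by rw [← ModuleCat.ofHom_comp, d_comp_d]; rfl)

/-- The cohomology `H_ω^n(Δ)` along `ω`: the coefficients are the bimodule
`Δ_ω = _{t(ω)} M_{s(ω)}`. -/
def cohomology {x y : V} (ω : Quiver.Path x y) (n : ℕ) : ModuleCat.{max u v w} k :=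
  (Δ.complex ω (Δ.hom x y)).homology n

end QSet

end PathCohomology

end

/-!
Fix the path `ω` from `x` to `y`, of length `m`, and let `S = A_y ⊗ A_xᵒᵖ`. For an `S`-module `N`,
write `F N` for the complex of cochains along `ω` with coefficients in the bimodule `N`, and `G N`
for `Hom_S(P, N)`, where `P` is a projective resolution of `M_ω`. The theorem holds for arbitrary
coefficients `N`, and is proved by dimension shifting in `N`
(`nonempty_homology_equiv_of_effaceable`). Both functors are exact, `F` because `k` is a field, so
it suffices to see that `H^m (F N)` and `H^0 (G N)` agree naturally, and that every `N` embeds in a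
module for which the cohomology of `F` above degree `m` and that of `G` above degree `0` vanish.

There are no trajectories of duration less than `m`, so `H^m (F N)` consists of cocycles. These are
the maps on `M_{a_m} × ⋯ × M_{a_1}` that are balanced over the inner algebras and linear over the
outer ones, and they are the compositions of one universal cocycle, with values in `M_ω`, with the
bimodule maps `M_ω → N` (`exists_isUniversalCocycle`).

The embedding is that of `N` in the coinduced bimodule `Hom_k(A_y, Hom_k(A_x, N))`, which has no
higher `Ext`. The vanishing of the cohomology of `F` on it (`isZero_homology_complex_coind`) is
shown by induction on `ω`, together with the theorem. A trajectory over `a ω` begins with waiting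
times at `t(a)`, followed by `a`. For coefficients in `Hom_k(A_{t(a)}, W)`, a homotopy removes these
waiting times: the first entry becomes the argument of the values, whose former argument is set
to `1`. This reduces cocycles along `a ω` to cocycles along `ω` with coefficients
in `Hom_k(M_a, W)` (`exists_dAux_eq_cons`). For `W = Hom_k(A_x, X)`, the theorem for `ω` identifies
their cohomology with `Ext(M_ω, Hom_k(M_a, Hom_k(A_x, X)))`. This is the dual
`Hom_k(Tor(M_a, M_ω), X)`, since a projective resolution of the bimodule `M_ω` is also one over the
algebra `A_{s(a)}`, and it vanishes in positive degrees because the path is Tor-vanishing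
(`isZero_homology_coind_of_isZero_tor`).
-/

noncomputable section

namespace PathCohomology

/-! ### Dimension shifting -/

section DimensionShift

open Limits

variable {k : Type u} [Field k]

/-- The connecting map of a short exact sequence of complexes is surjective if the middle term is
acyclic in degree `n + 1`. -/
theorem nonempty_homology_equiv_quotient {S : ShortComplex (CochainComplex (ModuleCat.{w} k) ℕ)}
    (hS : S.ShortExact) (n : ℕ) (h : IsZero (S.X₂.homology (n + 1))) :
    Nonempty (S.X₁.homology (n + 1) ≃ₗ[k]
      S.X₃.homology n ⧸ LinearMap.range (HomologicalComplex.homologyMap S.g n).hom) := by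
  have hn : (ComplexShape.up ℕ).Rel n (n + 1) := rfl
  have hex := (hS.homology_exact₃ n (n + 1) hn).moduleCat_range_eq_ker
  have := hS.epi_δ n (n + 1) hn h
  have hsurj := (ModuleCat.epi_iff_surjective (hS.δ n (n + 1) hn)).1 this
  exact ⟨((Submodule.quotEquivOfEq _ _ hex).trans
    (LinearMap.quotKerEquivOfSurjective _ hsurj)).symm⟩

theorem nonempty_homology_equiv {S : ShortComplex (CochainComplex (ModuleCat.{w} k) ℕ)}
    (hS : S.ShortExact) (n : ℕ) (h : IsZero (S.X₂.homology n))
    (h' : IsZero (S.X₂.homology (n + 1))) :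
    Nonempty (S.X₁.homology (n + 1) ≃ₗ[k] S.X₃.homology n) :=
  ⟨(hS.δIso n (n + 1) rfl h h').symm.toLinearEquiv⟩

/-- Two exact functors to cochain complexes have isomorphic cohomology if they do so, naturally, in
one degree, and if every object embeds in one for which both cohomologies vanish in all higher
degrees. -/
theorem nonempty_homology_equiv_of_effaceable {C : Type*} [Category* C] [Abelian C]
    (F : C ⥤ CochainComplex (ModuleCat.{v} k) ℕ) [F.PreservesZeroMorphisms]
    (G : C ⥤ CochainComplex (ModuleCat.{w} k) ℕ) [G.PreservesZeroMorphisms]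
    (hF : ∀ S : ShortComplex C, S.ShortExact → (S.map F).ShortExact)
    (hG : ∀ S : ShortComplex C, S.ShortExact → (S.map G).ShortExact) (m n : ℕ)
    (e : ∀ X, (F.obj X).homology m ≃ₗ[k] (G.obj X).homology n)
    (he : ∀ {X Y : C} (f : X ⟶ Y) (h : (F.obj X).homology m),
      e Y ((HomologicalComplex.homologyMap (F.map f) m).hom h) =
        (HomologicalComplex.homologyMap (G.map f) n).hom (e X h))
    (hI : ∀ X : C, ∃ (I : C) (i : X ⟶ I), Mono i ∧ ∀ r, 0 < r →
      IsZero ((F.obj I).homology (m + r)) ∧ IsZero ((G.obj I).homology (n + r))) (r : ℕ) (X : C) :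
    Nonempty ((F.obj X).homology (m + r) ≃ₗ[k] (G.obj X).homology (n + r)) := by
  induction r generalizing X with
  | zero => exact ⟨e X⟩
  | succ r ih =>
    obtain ⟨I, i, hi, hz⟩ := hI X
    let S : ShortComplex C := ShortComplex.mk i (cokernel.π i) (cokernel.condition i)
    have hS : S.ShortExact := { exact := S.exact_of_g_is_cokernel (cokernelIsCokernel i) }
    -- The connecting maps express the cohomology of `X` in degree `r + 1` by that of `I / X` in
    -- degree `r`; for `r = 0` this is only true modulo the image of the cohomology of `I`.
    rcases r.eq_zero_or_pos with rfl | hr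
    · obtain ⟨a⟩ := nonempty_homology_equiv_quotient (hF S hS) m (hz 1 one_pos).1
      obtain ⟨b⟩ := nonempty_homology_equiv_quotient (hG S hS) n (hz 1 one_pos).2
      refine ⟨a.trans ((Submodule.Quotient.equiv _ _ (e S.X₃) ?_).trans b.symm)⟩
      ext z
      constructor
      · rintro ⟨_, ⟨h, rfl⟩, rfl⟩
        exact ⟨e I h, (he S.g h).symm⟩
      · rintro ⟨h, rfl⟩
        exact ⟨_, ⟨(e I).symm h, rfl⟩, (he S.g _).trans
          (congrArg (HomologicalComplex.homologyMap (G.map S.g) n).hom ((e I).apply_symm_apply h))⟩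
    · obtain ⟨a⟩ := nonempty_homology_equiv (hF S hS) (m + r) (hz r hr).1 (hz (r + 1) r.succ_pos).1
      obtain ⟨b⟩ := nonempty_homology_equiv (hG S hS) (n + r) (hz r hr).2 (hz (r + 1) r.succ_pos).2
      obtain ⟨c⟩ := ih S.X₃
      exact ⟨a.trans (c.trans b.symm)⟩

variable (K L : CochainComplex (ModuleCat.{w} k) ℕ) (n : ℕ)

/-- The inclusion of the cohomology in degree `n` of a complex in the cochains of degree `n`, if
there are no coboundaries. -/
def homologyInclusion (hK : ∀ i, K.d i n = 0) : K.homology n ⟶ K.X n :=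
  haveI := K.isIso_homologyπ _ n rfl (hK _)
  inv (K.homologyπ n) ≫ K.iCycles n

variable {K L n}

theorem homologyInclusion_naturality (hK : ∀ i, K.d i n = 0) (hL : ∀ i, L.d i n = 0)
    (f : K ⟶ L) : HomologicalComplex.homologyMap f n ≫ homologyInclusion L n hL =
      homologyInclusion K n hK ≫ f.f n := by
  have := K.isIso_homologyπ _ n rfl (hK _)
  have := L.isIso_homologyπ _ n rfl (hL _)
  rw [← cancel_epi (K.homologyπ n)]
  simp [homologyInclusion]

theorem homologyInclusion_injective (hK : ∀ i, K.d i n = 0) :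
    Function.Injective (homologyInclusion K n hK) := by
  have := K.isIso_homologyπ _ n rfl (hK _)
  rw [← ModuleCat.mono_iff_injective]
  unfold homologyInclusion
  infer_instance

theorem mem_range_homologyInclusion (hK : ∀ i, K.d i n = 0) (z : K.X n) :
    z ∈ LinearMap.range (homologyInclusion K n hK).hom ↔ (K.d n (n + 1)).hom z = 0 := by
  have := K.isIso_homologyπ _ n rfl (hK _)
  have hn : (ComplexShape.up ℕ).next n = n + 1 := by simp
  constructor
  · rintro ⟨h, rfl⟩
    have : homologyInclusion K n hK ≫ K.d n (n + 1) = 0 := by simp [homologyInclusion]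
    exact LinearMap.congr_fun (congrArg ModuleCat.Hom.hom this) h
  · intro hz
    have hex : (ShortComplex.mk (K.iCycles n) (K.d n (n + 1)) (K.iCycles_d n (n + 1))).Exact :=
      ShortComplex.exact_of_f_is_kernel _ (K.cyclesIsKernel n (n + 1) hn)
    obtain ⟨c, hc⟩ := (ShortComplex.moduleCat_exact_iff _).1 hex z hz
    refine ⟨(K.homologyπ n).hom c, Eq.trans ?_ hc⟩
    have : K.homologyπ n ≫ homologyInclusion K n hK = K.iCycles n := by simp [homologyInclusion]
    exact LinearMap.congr_fun (congrArg ModuleCat.Hom.hom this) c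

/-- A description of the cocycles of degree `n` is one of the cohomology if there are no
coboundaries. -/
theorem exists_homology_equiv {T : Type*} [AddCommGroup T] [Module k T]
    (hK : ∀ i, K.d i n = 0) (α : T →ₗ[k] K.X n) (hα : Function.Injective α)
    (hα' : ∀ z, (K.d n (n + 1)).hom z = 0 ↔ z ∈ LinearMap.range α) :
    ∃ e : K.homology n ≃ₗ[k] T, ∀ h, α (e h) = (homologyInclusion K n hK).hom h := by
  have hr : LinearMap.range (homologyInclusion K n hK).hom = LinearMap.range α := by
    ext z
    rw [mem_range_homologyInclusion, hα']
  refine ⟨(LinearEquiv.ofInjective (homologyInclusion K n hK).hom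
    (homologyInclusion_injective hK)).trans ((LinearEquiv.ofEq _ _ hr).trans
      (LinearEquiv.ofInjective α hα).symm), fun h => ?_⟩
  have := LinearEquiv.apply_symm_apply (LinearEquiv.ofInjective α hα)
    (LinearEquiv.ofEq _ _ hr (LinearEquiv.ofInjective (homologyInclusion K n hK).hom
      (homologyInclusion_injective hK) h))
  exact congrArg Subtype.val this

theorem homology_equiv_naturality {T T' : Type*} [AddCommGroup T] [Module k T] [AddCommGroup T']
    [Module k T'] (hK : ∀ i, K.d i n = 0) (hL : ∀ i, L.d i n = 0) (f : K ⟶ L)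
    {α : T →ₗ[k] K.X n} {β : T' →ₗ[k] L.X n} (hβ : Function.Injective β)
    {e : K.homology n ≃ₗ[k] T} (he : ∀ h, α (e h) = (homologyInclusion K n hK).hom h)
    {e' : L.homology n ≃ₗ[k] T'} (he' : ∀ h, β (e' h) = (homologyInclusion L n hL).hom h)
    (t : T → T') (ht : ∀ p, β (t p) = (f.f n).hom (α p)) (h : K.homology n) :
    e' ((HomologicalComplex.homologyMap f n).hom h) = t (e h) := by
  apply hβ
  rw [he', ht, he]
  exact LinearMap.congr_fun
    (congrArg ModuleCat.Hom.hom (homologyInclusion_naturality hK hL f)) h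

/-- Vanishing of the cohomology in degree `n + 1`, in terms of elements. -/
theorem isZero_homology_succ_iff :
    IsZero (K.homology (n + 1)) ↔
      ∀ z, (K.d (n + 1) (n + 2)).hom z = 0 → ∃ z', (K.d n (n + 1)).hom z' = z := by
  rw [← K.exactAt_iff_isZero_homology,
    K.exactAt_iff' n (n + 1) (n + 2) (by simp) (by simp), ShortComplex.moduleCat_exact_iff]
  rfl

end DimensionShift

/-! ### Bimodules as modules over the enveloping algebra -/

namespace KBimodule

variable {k : Type u} [Field k] {C B A : Type u} [Ring C] [Algebra k C] [Ring B] [Algebra k B]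
  [Ring A] [Algebra k A]

/-- A `k`-linear map of bimodules that commutes with both actions. -/
structure IsHom {X Y : KBimodule k B A} (f : X.carrier →ₗ[k] Y.carrier) : Prop where
  map_left : ∀ (b : B) (p : X.carrier), f (b • p) = b • f p
  map_right : ∀ (a : Aᵐᵒᵖ) (p : X.carrier), f (a • p) = a • f p

/-- The bimodule underlying a left module over `B ⊗ Aᵒᵖ`, by restriction of scalars. -/
def ofModule (N : ModuleCat.{u} (B ⊗[k] Aᵐᵒᵖ)) : KBimodule k B A :=
  letI : Module k N := Module.compHom N (algebraMap k (B ⊗[k] Aᵐᵒᵖ))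
  letI : Module B N := Module.compHom N
    (Algebra.TensorProduct.includeLeft : B →ₐ[k] B ⊗[k] Aᵐᵒᵖ).toRingHom
  letI : Module Aᵐᵒᵖ N := Module.compHom N
    (Algebra.TensorProduct.includeRight : Aᵐᵒᵖ →ₐ[k] B ⊗[k] Aᵐᵒᵖ).toRingHom
  { carrier := N
    left_tower := ⟨fun c b p => by
      change ((c • b) ⊗ₜ[k] (1 : Aᵐᵒᵖ)) • (show N from p) =
        algebraMap k (B ⊗[k] Aᵐᵒᵖ) c • (b ⊗ₜ[k] (1 : Aᵐᵒᵖ)) • (show N from p)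
      rw [← mul_smul, ← Algebra.smul_def, TensorProduct.smul_tmul']⟩
    right_tower := ⟨fun c a p => by
      change ((1 : B) ⊗ₜ[k] (c • a)) • (show N from p) =
        algebraMap k (B ⊗[k] Aᵐᵒᵖ) c • ((1 : B) ⊗ₜ[k] a) • (show N from p)
      rw [← mul_smul, ← Algebra.smul_def, TensorProduct.tmul_smul]⟩
    left_right := ⟨fun b a p => by
      change (b ⊗ₜ[k] (1 : Aᵐᵒᵖ)) • ((1 : B) ⊗ₜ[k] a) • (show N from p) =
        ((1 : B) ⊗ₜ[k] a) • (b ⊗ₜ[k] (1 : Aᵐᵒᵖ)) • (show N from p)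
      rw [← mul_smul, ← mul_smul]
      simp⟩ }

section ofModule

variable {N N' : ModuleCat.{u} (B ⊗[k] Aᵐᵒᵖ)}

instance : Module (B ⊗[k] Aᵐᵒᵖ) (ofModule N).carrier := inferInstanceAs (Module _ N)

theorem tmul_smul_ofModule (b : B) (a : Aᵐᵒᵖ) (p : (ofModule N).carrier) :
    (b ⊗ₜ[k] a) • p = b • a • p := by
  change _ = (b ⊗ₜ[k] (1 : Aᵐᵒᵖ)) • ((1 : B) ⊗ₜ[k] a) • p
  rw [← mul_smul]
  simp

/-- A morphism of modules over `B ⊗ Aᵒᵖ`, as a map of bimodules. -/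
def ofModuleMap (g : N ⟶ N') : (ofModule N).carrier →ₗ[k] (ofModule N').carrier where
  toFun p := g.hom p
  map_add' p q := map_add g.hom p q
  map_smul' c p := map_smul g.hom (algebraMap k (B ⊗[k] Aᵐᵒᵖ) c) p

theorem isHom_ofModuleMap (g : N ⟶ N') : IsHom (ofModuleMap g) where
  map_left b p := map_smul g.hom (b ⊗ₜ[k] (1 : Aᵐᵒᵖ)) p
  map_right a p := map_smul g.hom ((1 : B) ⊗ₜ[k] a) p

theorem IsHom.map_enveloping {f : (ofModule N).carrier →ₗ[k] (ofModule N').carrier} (hf : IsHom f)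
    (s : B ⊗[k] Aᵐᵒᵖ) (p : (ofModule N).carrier) : f (s • p) = s • f p := by
  induction s with
  | zero =>
    exact (congrArg f (zero_smul (B ⊗[k] Aᵐᵒᵖ) p)).trans
      ((map_zero f).trans (zero_smul (B ⊗[k] Aᵐᵒᵖ) (f p)).symm)
  | add s t hs ht => rw [add_smul, add_smul, map_add, hs, ht]
  | tmul b a => rw [tmul_smul_ofModule, tmul_smul_ofModule, hf.map_left, hf.map_right]

/-- A map of bimodules, as a morphism of modules over `B ⊗ Aᵒᵖ`. -/
def IsHom.toModuleMap {f : (ofModule N).carrier →ₗ[k] (ofModule N').carrier} (hf : IsHom f) :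
    N ⟶ N' :=
  ModuleCat.ofHom (X := N) (Y := N')
    { toFun := fun p => f p
      map_add' := fun p q => map_add f p q
      map_smul' := fun s p => hf.map_enveloping s p }

end ofModule

/-- A bimodule is isomorphic to the one underlying the module over `B ⊗ Aᵒᵖ` it defines: the map is
the identity. -/
def toOfModule (X : KBimodule k B A) : X.carrier ≃ₗ[k] (ofModule X.toModuleCat).carrier where
  toFun p := p
  invFun p := p
  left_inv _ := rfl
  right_inv _ := rfl
  map_add' _ _ := rfl
  map_smul' c p := by
    let : Module (B ⊗[k] Aᵐᵒᵖ) X.carrier := TensorProduct.Algebra.module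
    change c • p = algebraMap k (B ⊗[k] Aᵐᵒᵖ) c • p
    rw [Algebra.TensorProduct.algebraMap_apply, TensorProduct.Algebra.smul_def, one_smul,
      algebraMap_smul]

theorem isHom_toOfModule (X : KBimodule k B A) : IsHom X.toOfModule.toLinearMap where
  map_left b p := by
    let : Module (B ⊗[k] Aᵐᵒᵖ) X.carrier := TensorProduct.Algebra.module
    change b • p = (b ⊗ₜ[k] (1 : Aᵐᵒᵖ)) • p
    rw [TensorProduct.Algebra.smul_def, one_smul]
  map_right a p := by
    let : Module (B ⊗[k] Aᵐᵒᵖ) X.carrier := TensorProduct.Algebra.module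
    change a • p = ((1 : B) ⊗ₜ[k] a) • p
    rw [TensorProduct.Algebra.smul_def, one_smul]

theorem IsHom.comp {X Y Z : KBimodule k B A} {g : Y.carrier →ₗ[k] Z.carrier}
    {f : X.carrier →ₗ[k] Y.carrier} (hg : IsHom g) (hf : IsHom f) : IsHom (g ∘ₗ f) where
  map_left b p := (congrArg g (hf.map_left b p)).trans (hg.map_left b _)
  map_right a p := (congrArg g (hf.map_right a p)).trans (hg.map_right a _)

theorem IsHom.symm {X Y : KBimodule k B A} {e : X.carrier ≃ₗ[k] Y.carrier}
    (he : IsHom e.toLinearMap) : IsHom e.symm.toLinearMap where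
  map_left b p := e.injective <| by
    have := he.map_left b (e.symm p)
    simp only [LinearEquiv.coe_coe, LinearEquiv.apply_symm_apply] at this ⊢
    exact this.symm
  map_right a p := e.injective <| by
    have := he.map_right a (e.symm p)
    simp only [LinearEquiv.coe_coe, LinearEquiv.apply_symm_apply] at this ⊢
    exact this.symm

/-! ### Coinduced bimodules -/

/-- The `B`-`A`-bimodule `Hom_k(M, W)` for a `C`-`B`-bimodule `M` and a right `A`-module `W`, with
`(b φ)(m) = φ(m b)` and `(φ a)(m) = φ(m) a`. -/
def homBimodule (M : KBimodule k C B) (A : Type u) [Ring A] [Algebra k A] (W : Type u)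
    [AddCommGroup W] [Module k W] [Module Aᵐᵒᵖ W] [IsScalarTower k Aᵐᵒᵖ W] :
    KBimodule k B A :=
  letI : Module B (M.carrier →ₗ[k] W) :=
    { smul := fun b φ => φ ∘ₗ Algebra.lsmul k k M.carrier (op b)
      one_smul := fun φ => LinearMap.ext fun m => congrArg φ (one_smul Bᵐᵒᵖ m)
      mul_smul := fun b b' φ => LinearMap.ext fun m => congrArg φ (mul_smul (op b') (op b) m)
      smul_zero := fun _ => rfl
      smul_add := fun _ _ _ => rfl
      add_smul := fun b b' φ => LinearMap.ext fun m =>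
        (congrArg φ (add_smul (op b) (op b') m)).trans (map_add φ _ _)
      zero_smul := fun φ => LinearMap.ext fun m =>
        (congrArg φ (zero_smul Bᵐᵒᵖ m)).trans (map_zero φ) }
  { carrier := M.carrier →ₗ[k] W
    left_tower := ⟨fun c b φ => LinearMap.ext fun m =>
      (congrArg φ (smul_assoc c (op b) m)).trans (map_smul φ _ _)⟩
    left_right := ⟨fun _ _ _ => rfl⟩ }

/-- The coinduced right `A`-module `Hom_k(A, X)`, with `(w a)(a') = w(a a')`. -/
def CoindRight (k : Type u) [Field k] (A : Type u) [Ring A] [Algebra k A] (X : Type u)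
    [AddCommGroup X] [Module k X] : Type u :=
  A →ₗ[k] X

namespace CoindRight

variable {X : Type u} [AddCommGroup X] [Module k X]

instance : AddCommGroup (CoindRight k A X) := inferInstanceAs (AddCommGroup (A →ₗ[k] X))

instance : Module k (CoindRight k A X) := inferInstanceAs (Module k (A →ₗ[k] X))

instance : Module Aᵐᵒᵖ (CoindRight k A X) where
  smul a w := LinearMap.comp (show A →ₗ[k] X from w) (LinearMap.mulLeft k a.unop)
  one_smul w := LinearMap.ext fun a' => congrArg (show A →ₗ[k] X from w) (one_mul a')
  mul_smul a b w := LinearMap.ext fun a' =>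
    congrArg (show A →ₗ[k] X from w) (mul_assoc b.unop a.unop a')
  smul_zero _ := rfl
  smul_add _ _ _ := rfl
  add_smul a b w := LinearMap.ext fun a' =>
    (congrArg (show A →ₗ[k] X from w) (add_mul a.unop b.unop a')).trans (LinearMap.map_add _ _ _)
  zero_smul w := LinearMap.ext fun a' =>
    (congrArg (show A →ₗ[k] X from w) (zero_mul a')).trans (LinearMap.map_zero _)

instance : IsScalarTower k Aᵐᵒᵖ (CoindRight k A X) where
  smul_assoc c a w := LinearMap.ext fun a' =>
    (congrArg (show A →ₗ[k] X from w) (smul_mul_assoc c a.unop a')).trans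
      (LinearMap.map_smul _ _ _)

end CoindRight

/-- The bimodule `Hom_k(M, Hom_k(A, X))`. -/
abbrev coind (M : KBimodule k C B) (A : Type u) [Ring A] [Algebra k A] (X : Type u)
    [AddCommGroup X] [Module k X] : KBimodule k B A :=
  homBimodule M A (CoindRight k A X)


/-- The map `p ↦ (b ↦ (a ↦ b p a))` of a bimodule to the coinduced bimodule. -/
def toCoind (X : KBimodule k B A) :
    X.carrier →ₗ[k] (coind (regular k B) A X.carrier).carrier :=
  let L : X.carrier →ₗ[k] B →ₗ[k] A →ₗ[k] X.carrier :=
    LinearMap.mk₂ k (fun p b => (Algebra.lsmul k k X.carrier b) ∘ₗ QSet.rightMul k A X.carrier p)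
      (fun p q b => LinearMap.ext fun a => by simp)
      (fun c p b => LinearMap.ext fun a => by simp [smul_comm b c])
      (fun p b b' => LinearMap.ext fun a => by simp)
      (fun c p b => LinearMap.ext fun a => by simp)
  L

theorem isHom_toCoind (X : KBimodule k B A) : IsHom X.toCoind where
  map_left b p := LinearMap.ext fun (b' : B) => LinearMap.ext fun (a : A) => by
    change b' • op a • b • p = (b' * b) • op a • p
    rw [mul_smul, smul_comm b (op a) p]
  map_right a p := LinearMap.ext fun (b : B) => LinearMap.ext fun (a' : A) => by
    change b • op a' • a • p = b • op (a.unop * a') • p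
    rw [op_mul, mul_smul, op_unop]

theorem toCoind_injective (X : KBimodule k B A) : Function.Injective X.toCoind := by
  intro p q h
  have : (1 : B) • op (1 : A) • p = (1 : B) • op (1 : A) • q :=
    LinearMap.congr_fun (LinearMap.congr_fun (show (show B →ₗ[k] CoindRight k A X.carrier from
      X.toCoind p) = X.toCoind q from h) (1 : B)) (1 : A)
  simpa using this

end KBimodule

/-! ### The cochain complex as a functor of the coefficients -/

namespace QSet

variable {k : Type u} [Field k] {V : Type w} [Quiver.{v} V] {Δ : QSet k V} {x y : V}
  {ω : Quiver.Path x y}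

theorem d_comp_apply {X Y : KBimodule k (Δ.A y) (Δ.A x)} {l : X.carrier →ₗ[k] Y.carrier}
    (hl : KBimodule.IsHom l) {n : ℕ} (f : Δ.Cochain ω X.carrier n) :
    Δ.d ω Y n (fun τ => l ∘ₗ f τ) = fun σ => l ∘ₗ Δ.d ω X n f σ :=
  funext fun σ => dAux_comp _ _ l hl.map_right hl.map_left f σ

theorem complex_d (X : KBimodule k (Δ.A y) (Δ.A x)) (n : ℕ) :
    (Δ.complex ω X).d n (n + 1) = ModuleCat.ofHom (Δ.d ω X n) :=
  CochainComplex.of_d (fun n => ModuleCat.of k (Δ.Cochain ω X.carrier n))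
    (fun n => ModuleCat.ofHom (Δ.d ω X n)) n

/-- Composition of cochains with a map of bimodules. -/
def complexMap (ω : Quiver.Path x y) {X Y : KBimodule k (Δ.A y) (Δ.A x)}
    {l : X.carrier →ₗ[k] Y.carrier} (hl : KBimodule.IsHom l) : Δ.complex ω X ⟶ Δ.complex ω Y :=
  CochainComplex.ofHom
    (fun n => ModuleCat.ofHom
      { toFun := fun f τ => l ∘ₗ f τ
        map_add' := fun f g => funext fun τ => LinearMap.comp_add (f τ) (g τ) l
        map_smul' := fun c f => funext fun τ => LinearMap.comp_smul l c (f τ) })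
    (fun n => by
      rw [complex_d, complex_d]
      ext : 1
      exact LinearMap.ext fun f => d_comp_apply hl f)

theorem complex_hom_ext {K : CochainComplex (ModuleCat.{max u v w} k) ℕ}
    {X : KBimodule k (Δ.A y) (Δ.A x)} {g h : K ⟶ Δ.complex ω X}
    (H : ∀ n (f : K.X n) (τ : Traj ω n) (s : Δ.eval τ),
      (show Δ.Cochain ω X.carrier n from (g.f n).hom f) τ s =
        (show Δ.Cochain ω X.carrier n from (h.f n).hom f) τ s) : g = h := by
  ext n : 2
  exact LinearMap.ext fun f => funext fun τ => LinearMap.ext fun s => H n f τ s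

/-- Isomorphic bimodules have isomorphic cochain complexes. -/
def complexIso (ω : Quiver.Path x y) {X Y : KBimodule k (Δ.A y) (Δ.A x)}
    {e : X.carrier ≃ₗ[k] Y.carrier} (he : KBimodule.IsHom e.toLinearMap) :
    Δ.complex ω X ≅ Δ.complex ω Y where
  hom := complexMap ω he
  inv := complexMap ω he.symm
  hom_inv_id := complex_hom_ext fun _ _ _ _ => e.symm_apply_apply _
  inv_hom_id := complex_hom_ext fun _ _ _ _ => e.apply_symm_apply _

variable (Δ) in
/-- The functor sending a module over `A_{t(ω)} ⊗ A_{s(ω)}ᵒᵖ` to the complex of cochains along `ω`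
with coefficients in the underlying bimodule. -/
def complexFunctor (ω : Quiver.Path x y) :
    ModuleCat.{u} (Δ.A y ⊗[k] (Δ.A x)ᵐᵒᵖ) ⥤ CochainComplex (ModuleCat.{max u v w} k) ℕ where
  obj N := Δ.complex ω (KBimodule.ofModule N)
  map g := complexMap ω (KBimodule.isHom_ofModuleMap g)
  map_id _ := complex_hom_ext fun _ _ _ _ => rfl
  map_comp _ _ := complex_hom_ext fun _ _ _ _ => rfl

instance (ω : Quiver.Path x y) : (Δ.complexFunctor ω).PreservesZeroMorphisms where
  map_zero _ _ := complex_hom_ext fun _ _ _ _ => rfl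

theorem complexFunctor_shortExact (ω : Quiver.Path x y)
    (S : ShortComplex (ModuleCat.{u} (Δ.A y ⊗[k] (Δ.A x)ᵐᵒᵖ))) (hS : S.ShortExact) :
    (S.map (Δ.complexFunctor ω)).ShortExact := by
  refine HomologicalComplex.shortExact_of_degreewise_shortExact _ fun n => ?_
  have hf : Function.Injective (KBimodule.ofModuleMap S.f) := hS.moduleCat_injective_f
  have hg : Function.Surjective (KBimodule.ofModuleMap S.g) := hS.moduleCat_surjective_g
  have hex : LinearMap.range (KBimodule.ofModuleMap S.f) =
      LinearMap.ker (KBimodule.ofModuleMap S.g) := by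
    ext p
    exact Iff.symm (((ShortComplex.ShortExact.moduleCat_exact_iff_function_exact S).1 hS.exact) p)
  -- Over the field `k`, the surjection `S.g` has a linear section, along which cochains lift.
  obtain ⟨r, hr⟩ := (KBimodule.ofModuleMap S.g).exists_rightInverse_of_surjective
    (LinearMap.range_eq_top.2 hg)
  let i := LinearEquiv.ofInjective (KBimodule.ofModuleMap S.f) hf
  have hcomp : KBimodule.ofModuleMap S.g ∘ₗ KBimodule.ofModuleMap S.f = 0 :=
    LinearMap.range_le_ker_iff.1 hex.le
  refine ModuleCat.shortComplex_shortExact _ (fun f => ⟨fun h => ?_, ?_⟩) ?_ fun f => ?_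
  · change Δ.Cochain ω (KBimodule.ofModule S.X₂).carrier n at f
    have h' (τ : Traj ω n) (s : Δ.eval τ) :
        f τ s ∈ LinearMap.range (KBimodule.ofModuleMap S.f) := by
      rw [hex]
      exact LinearMap.congr_fun (congrFun h τ) s
    exact ⟨fun τ => i.symm.toLinearMap ∘ₗ (f τ).codRestrict _ (h' τ), funext fun τ =>
      LinearMap.ext fun s => congrArg Subtype.val (i.apply_symm_apply ⟨f τ s, h' τ s⟩)⟩
  · rintro ⟨g, rfl⟩
    change Δ.Cochain ω (KBimodule.ofModule S.X₁).carrier n at g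
    exact funext fun τ => LinearMap.ext fun s => LinearMap.congr_fun hcomp (g τ s)
  · intro f g h
    exact (funext fun τ => LinearMap.ext fun s => hf (LinearMap.congr_fun (congrFun h τ) s) :
      (show Δ.Cochain ω (KBimodule.ofModule S.X₁).carrier n from f) = g)
  · change Δ.Cochain ω (KBimodule.ofModule S.X₃).carrier n at f
    exact ⟨fun τ => r ∘ₗ f τ, funext fun τ =>
      LinearMap.ext fun s => LinearMap.congr_fun hr (f τ s)⟩

theorem isZero_homology_complex_iff (X : KBimodule k (Δ.A y) (Δ.A x)) (n : ℕ) :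
    Limits.IsZero ((Δ.complex ω X).homology (n + 1)) ↔
      ∀ f, Δ.d ω X (n + 1) f = 0 → ∃ g, Δ.d ω X n g = f := by
  rw [isZero_homology_succ_iff, complex_d, complex_d]
  rfl

end QSet

/-! ### Cochains with coinduced coefficients -/

namespace QSet

variable {k : Type u} [Field k] {V : Type w} [Quiver.{v} V] {Δ : QSet k V} {x y z : V}
  {ω : Quiver.Path x y} {n : ℕ} {a : y ⟶ z}
  {W : Type u} [AddCommGroup W] [Module k W]

variable (W) in
/-- The map `φ ↦ (m ↦ (b ↦ φ(b m)))`. -/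
def coextend (a : y ⟶ z) :
    ((Δ.M a).carrier →ₗ[k] W) →ₗ[k] (Δ.M a).carrier →ₗ[k] Δ.A z →ₗ[k] W :=
  ((LinearMap.llcomp k (Δ.A z) (Δ.M a).carrier W).flip ∘ₗ
    (Algebra.lsmul k k (A := Δ.A z) (Δ.M a).carrier).toLinearMap.flip).flip

/-- The cochain along `a ω` with coefficients in `Hom_k(A_{t(a)}, W)` that corresponds to a cochain
along `ω` with coefficients in `Hom_k(M_a, W)`: it is `m ⊗ s ↦ (b ↦ g(s)(b m))` on the trajectories
that begin with `a` and zero on the others. -/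
def extendHead (g : Δ.Cochain ω ((Δ.M a).carrier →ₗ[k] W) n) :
    Δ.Cochain (ω.cons a) (Δ.A z →ₗ[k] W) (n + 1)
  | .wait _ => 0
  | .step τ _ => liftStep ((coextend W a).flip.compl₂ (g τ))

theorem headStep_extendHead (g : Δ.Cochain ω ((Δ.M a).carrier →ₗ[k] W) n) :
    headStep (extendHead g) = fun τ => coextend W a ∘ₗ g τ := rfl

theorem headAct_extendHead (g : Δ.Cochain ω ((Δ.M a).carrier →ₗ[k] W) n)
    (τ : Traj (ω.cons a) (n + 1)) (s : Δ.eval τ) (b : Δ.A z) :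
    headAct (extendHead g) τ s b = rhoWait W z b (extendHead g τ s) := by
  cases τ with
  | wait τ => rfl
  | step τ a =>
    suffices H : (headAct (extendHead g) (τ.step a)).flip b =
        rhoWait W z b ∘ₗ extendHead g (τ.step a) from LinearMap.congr_fun H s
    refine ext_step fun m t => LinearMap.ext fun b' => ?_
    exact congrArg (g τ t) (smul_smul b' b m)

variable [Module (Δ.A x)ᵐᵒᵖ W] [IsScalarTower k (Δ.A x)ᵐᵒᵖ W]

variable (Δ W y) in
/-- The retraction `Φ ↦ (b ↦ Φ(b)(1))` of the embedding of `Hom_k(A_y, W)` in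
`Hom_k(A_y, Hom_k(A_y, W))` given by the action of `A_y`. -/
def evalOne : (Δ.A y →ₗ[k] Δ.A y →ₗ[k] W) →ₗ[k] Δ.A y →ₗ[k] W :=
  (LinearMap.applyₗ (1 : Δ.A y)).compRight k (M := Δ.A y)

/-- The maps `evalOne ∘ headWait` are a homotopy, up to the terms in which the algebra `A_{t(ω)}`
acts on the arrow in front of a trajectory. -/
theorem dAux_evalOne_headWait (f : Δ.Cochain ω (Δ.A y →ₗ[k] W) (n + 1))
    (hf : dAux (rhoWait W y) f = 0) :
    dAux (rhoWait W y) (fun τ => evalOne Δ y W ∘ₗ headWait f τ) =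
      f - fun τ => evalOne Δ y W ∘ₗ headAct f τ := by
  funext τ
  refine (dAux_comp (rhoWait (Δ.A y →ₗ[k] W) y) (rhoWait W y) (evalOne Δ y W) (fun _ _ => rfl)
    (fun b Φ => LinearMap.ext fun b' => rfl) (headWait f) τ).trans
      (LinearMap.ext fun s => LinearMap.ext fun b => ?_)
  have h := dAux_wait (rhoWait W y) f τ b s
  rw [hf] at h
  have h' := LinearMap.congr_fun (sub_eq_zero.1 h.symm) 1
  refine h'.symm.trans ?_
  change f τ s (1 * b) - headAct f τ s b 1 = f τ s b - headAct f τ s b 1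
  rw [one_mul]

/-- Along the path of length zero, no trajectory begins with an arrow, so that
`evalOne ∘ headWait` is a contracting homotopy in positive degrees. -/
theorem exists_dAux_eq_nil (f : Δ.Cochain (Quiver.Path.nil : Quiver.Path x x)
    (Δ.A x →ₗ[k] W) (n + 1)) (hf : dAux (rhoWait W x) f = 0) :
    ∃ g, dAux (rhoWait W x) g = f := by
  refine ⟨_, (dAux_evalOne_headWait f hf).trans (sub_eq_self.2 (funext fun τ => ?_))⟩
  cases τ with
  | wait τ => exact LinearMap.comp_zero _

/-- Up to sign, `extendHead` is a map of complexes of degree one. -/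
theorem dAux_extendHead (g : Δ.Cochain ω ((Δ.M a).carrier →ₗ[k] W) n) :
    dAux (rhoWait W z) (extendHead g) = -extendHead (dAux (rhoStep W a) g) := by
  funext σ
  cases σ with
  | wait τ =>
    refine ext_wait fun b s => ?_
    have h : headWait (extendHead g) = 0 := rfl
    rw [dAux_wait, h, map_zero, headAct_extendHead, sub_self]
    exact (zero_sub _).trans rfl
  | step τ a =>
    refine ext_step fun m s => ?_
    rw [dAux_step, headStep_extendHead]
    have h := dAux_comp (rhoStep W a) (rhoStep (Δ.A z →ₗ[k] W) a) (coextend W a)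
      (fun _ _ => rfl)
      (fun b φ => LinearMap.ext fun m => LinearMap.ext fun c =>
        congrArg φ (smul_comm c (op b) m).symm) g τ
    rw [h]
    rfl

/-- Exactness of the complex along `ω` with coefficients in `Hom_k(M_a, W)` implies exactness of the
one along `a ω` with coefficients in `Hom_k(A_{t(a)}, W)`: the homotopy above reduces
a cocycle to one that comes from `ω`. -/
theorem exists_dAux_eq_cons
    (h : ∀ g : Δ.Cochain ω ((Δ.M a).carrier →ₗ[k] W) (n + 1), dAux (rhoStep W a) g = 0 →
      ∃ g', dAux (rhoStep W a) g' = g)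
    (f : Δ.Cochain (ω.cons a) (Δ.A z →ₗ[k] W) (n + 2)) (hf : dAux (rhoWait W z) f = 0) :
    ∃ f', dAux (rhoWait W z) f' = f := by
  -- What the homotopy leaves of `f` is `extendHead` of the cocycle
  -- `s ↦ (m ↦ f(m ⊗ s)(1))` along `ω`.
  let l : ((Δ.M a).carrier →ₗ[k] Δ.A z →ₗ[k] W) →ₗ[k] (Δ.M a).carrier →ₗ[k] W :=
    (LinearMap.applyₗ (1 : Δ.A z)).compRight k
  obtain ⟨g', hg'⟩ := h (fun τ => l ∘ₗ headStep f τ) <| funext fun σ => by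
    rw [dAux_comp (rhoStep (Δ.A z →ₗ[k] W) a) (rhoStep W a) l (fun _ _ => rfl) (fun _ _ => rfl)]
    refine LinearMap.ext fun s => LinearMap.ext fun m => ?_
    have h := dAux_step a (rhoWait W z) f σ m s
    rw [hf] at h
    exact LinearMap.congr_fun (neg_eq_zero.1 h.symm) 1
  have hact : (fun τ => evalOne Δ z W ∘ₗ headAct f τ) =
      extendHead (fun τ => l ∘ₗ headStep f τ) := by
    funext τ
    cases τ with
    | wait τ => exact LinearMap.comp_zero _
    | step τ a => exact ext_step fun m s => rfl
  refine ⟨(fun τ => evalOne Δ z W ∘ₗ headWait f τ) - extendHead g', ?_⟩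
  rw [map_sub, dAux_evalOne_headWait f hf, hact, dAux_extendHead, hg']
  abel

end QSet

/-! ### The universal cocycle of lowest degree -/

namespace KBimodule

variable {k : Type u} [Field k] {C B A : Type u} [Ring C] [Algebra k C] [Ring B] [Algebra k B]
  [Ring A] [Algebra k A]

/-- A bilinear map `t` of bimodules that has the universal property of `N × M → N ⊗_B M`. -/
structure IsBalancedTensor (N : KBimodule k C B) (M : KBimodule k B A) (T : KBimodule k C A)
    (t : N.carrier →ₗ[k] M.carrier →ₗ[k] T.carrier) : Prop where
  balanced : ∀ (b : B) n m, t (op b • n) m = t n (b • m)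
  map_left : ∀ (c : C) n m, t (c • n) m = c • t n m
  map_right : ∀ (a : Aᵐᵒᵖ) n m, t n (a • m) = a • t n m
  exists_lift : ∀ {X : Type u} [AddCommGroup X] [Module k X]
    (β : N.carrier →ₗ[k] M.carrier →ₗ[k] X), (∀ (b : B) n m, β (op b • n) m = β n (b • m)) →
    ∃ φ : T.carrier →ₗ[k] X, ∀ n m, φ (t n m) = β n m
  hom_ext : ∀ {X : Type u} [AddCommGroup X] [Module k X] {φ ψ : T.carrier →ₗ[k] X},
    (∀ n m, φ (t n m) = ψ (t n m)) → φ = ψ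

theorem isBalancedTensor_tensor (N : KBimodule k C B) (M : KBimodule k B A) :
    IsBalancedTensor N M (N.tensor M)
      ((TensorProduct.mk k N.carrier M.carrier).compr₂
        (balancedRel k B N.carrier M.carrier).mkQ) where
  balanced b n m := sub_eq_zero.1 <| by
    change (balancedRel k B N.carrier M.carrier).mkQ _ -
      (balancedRel k B N.carrier M.carrier).mkQ _ = 0
    rw [← map_sub, Submodule.mkQ_apply, Submodule.Quotient.mk_eq_zero]
    exact Submodule.subset_span ⟨n, b, m, rfl⟩
  map_left _ _ _ := rfl
  map_right _ _ _ := rfl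
  exists_lift β hβ := ⟨(balancedRel k B N.carrier M.carrier).liftQ (TensorProduct.lift β) <| by
    rw [balancedRel, Submodule.span_le]
    rintro _ ⟨n, b, m, rfl⟩
    simp [hβ], fun _ _ => rfl⟩
  hom_ext h := BalTensor.ext k B h

theorem isBalancedTensor_regular (N : KBimodule k C B) :
    IsBalancedTensor N (regular k B) N (QSet.rightMul k B N.carrier) where
  balanced b n m := by
    have h (m : B) : op m • op b • n = op (b * m) • n := (mul_smul _ _ _).symm
    exact h m
  map_left c n m := (smul_comm c (op (show B from m)) n).symm
  map_right a n m := by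
    have h (m : B) : (a * op m) • n = a • op m • n := mul_smul _ _ _
    exact h m
  exists_lift β hβ := ⟨β.flip (1 : B), fun n m =>
    (hβ m n (1 : B)).trans (congrArg (β n) (mul_one (M := B) m))⟩
  hom_ext {X _ _ φ ψ} h := LinearMap.ext fun n => by
    have := h n (1 : B)
    change φ (op (1 : B) • n) = ψ (op (1 : B) • n) at this
    simpa using this

end KBimodule

theorem Traj.length_le {V : Type w} [Quiver.{v} V] {x : V} :
    ∀ {y : V} {ω : Quiver.Path x y} {n : ℕ}, Traj ω n → ω.length ≤ n
  | _, _, _, .nil => le_rfl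
  | _, _, _, .wait τ => τ.length_le.trans (Nat.le_succ _)
  | _, _, _, .step τ _ => Nat.succ_le_succ τ.length_le

namespace QSet

variable {k : Type u} [Field k] {V : Type w} [Quiver.{v} V] {Δ : QSet k V} {x y z : V}
  {ω : Quiver.Path x y}

open KBimodule

/-- A cocycle `u` of lowest degree along `ω`, with coefficients in `M`, of which every other one is
the composition with a unique map of bimodules. -/
structure IsUniversalCocycle {M : KBimodule k (Δ.A y) (Δ.A x)}
    (u : Δ.Cochain ω M.carrier ω.length) : Prop where
  d_eq_zero : Δ.d ω M ω.length u = 0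
  exists_hom : ∀ {X : KBimodule k (Δ.A y) (Δ.A x)} (f : Δ.Cochain ω X.carrier ω.length),
    Δ.d ω X ω.length f = 0 → ∃ φ : M.carrier →ₗ[k] X.carrier, IsHom φ ∧ ∀ τ, φ ∘ₗ u τ = f τ
  hom_ext : ∀ {X : KBimodule k (Δ.A y) (Δ.A x)} {φ ψ : M.carrier →ₗ[k] X.carrier},
    IsHom φ → IsHom ψ → (∀ τ, φ ∘ₗ u τ = ψ ∘ₗ u τ) → φ = ψ

variable (Δ x) in
/-- The cochain `1` along the path of length zero. -/
def unitCochain : Δ.Cochain (Quiver.Path.nil : Quiver.Path x x)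
    (regular k (Δ.A x)).carrier 0
  | .nil => LinearMap.toSpanSingleton k (Δ.A x) 1

theorem isUniversalCocycle_unitCochain :
    IsUniversalCocycle (ω := .nil) (M := regular k (Δ.A x)) (unitCochain Δ x) where
  d_eq_zero := funext fun σ => by
    cases σ with
    | wait τ =>
      cases τ with
      | nil =>
        refine ext_wait fun b c => ?_
        change dAux _ _ _ _ = _
        refine (dAux_wait_nil _ _ _ _).trans ?_
        have h (c : k) : b * (c • (1 : Δ.A x)) - (c • (1 : Δ.A x)) * b = 0 := by simp
        exact h c
  exists_hom {X} f hf := by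
    have h (b : Δ.A x) : b • f .nil (1 : k) = op b • f .nil (1 : k) := by
      have := LinearMap.congr_fun (congrFun hf (.wait .nil)) (consWait .nil b (1 : k))
      exact sub_eq_zero.1 ((dAux_wait_nil _ f b (1 : k)).symm.trans this)
    let φ : Δ.A x →ₗ[k] X.carrier :=
      (Algebra.lsmul k k X.carrier).toLinearMap.flip (f .nil (1 : k))
    refine ⟨φ, ⟨fun b p => mul_smul (α := Δ.A x) b p _, fun a p => ?_⟩, fun τ => ?_⟩
    · change (((show Δ.A x from p) * a.unop) • f .nil (1 : k) : X.carrier) =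
        a • (show Δ.A x from p) • f .nil (1 : k)
      rw [mul_smul, h, op_unop, smul_comm]
    · cases τ with
      | nil =>
        refine LinearMap.ext_ring ?_
        change ((1 : k) • (1 : Δ.A x)) • f .nil (1 : k) = f .nil (1 : k)
        rw [one_smul, one_smul]
  hom_ext {X φ ψ} hφ hψ h := LinearMap.ext fun b => by
    have h1 : φ (1 : Δ.A x) = ψ (1 : Δ.A x) := by
      have := LinearMap.congr_fun (h .nil) (1 : k)
      change φ ((1 : k) • (1 : Δ.A x)) = ψ ((1 : k) • (1 : Δ.A x)) at this
      rwa [one_smul] at this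
    have hb : b = (show Δ.A x from b) • (show (regular k (Δ.A x)).carrier from (1 : Δ.A x)) :=
      (mul_one (M := Δ.A x) b).symm
    rw [hb, hφ.map_left, hψ.map_left]
    exact congrArg _ h1

variable {a : y ⟶ z} {M : KBimodule k (Δ.A y) (Δ.A x)} {T : KBimodule k (Δ.A z) (Δ.A x)}
  {t : (Δ.M a).carrier →ₗ[k] M.carrier →ₗ[k] T.carrier} {n : ℕ}

/-- The cochain `m ⊗ s ↦ t(m, u(s))` along `a ω`, for a cochain `u` along `ω` and a bilinear
map `t`. -/
def consCochain (t : (Δ.M a).carrier →ₗ[k] M.carrier →ₗ[k] T.carrier)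
    (u : Δ.Cochain ω M.carrier n) : Δ.Cochain (ω.cons a) T.carrier (n + 1)
  | .wait _ => 0
  | .step τ _ => liftStep (t.compl₂ (u τ))

/-- In lowest degree along `a ω`, no trajectory begins with a waiting time. -/
theorem headWait_eq_zero {X : Type u} [AddCommGroup X] [Module k X]
    (f : Δ.Cochain (ω.cons a) X (ω.length + 1)) : headWait f = 0 :=
  funext fun τ => absurd τ.length_le (Nat.not_succ_le_self _)

/-- The cocycle condition in lowest degree along `a ω`: it is the one along `ω`, together with
linearity over the algebra `A_{t(a)}`. -/
theorem d_cons_eq_zero_iff {X : KBimodule k (Δ.A z) (Δ.A x)}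
    (f : Δ.Cochain (ω.cons a) X.carrier (ω.length + 1)) :
    Δ.d (ω.cons a) X (ω.length + 1) f = 0 ↔
      dAux (rhoStep X.carrier a) (headStep f) = 0 ∧ ∀ (τ : Traj ω ω.length) (b : Δ.A z) m s,
        f (τ.step a) (consStep τ a (b • m) s) = b • f (τ.step a) (consStep τ a m s) := by
  have hstep (σ : Traj ω (ω.length + 1)) (m) (s) : Δ.d (ω.cons a) X (ω.length + 1) f (σ.step a)
      (consStep σ a m s) = -dAux (rhoStep X.carrier a) (headStep f) σ s m := dAux_step a _ f σ m s
  have hwait (τ : Traj ω ω.length) (b : Δ.A z) (m) (s) :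
      Δ.d (ω.cons a) X (ω.length + 1) f (τ.step a).wait (consWait _ b (consStep τ a m s)) =
        b • f (τ.step a) (consStep τ a m s) - f (τ.step a) (consStep τ a (b • m) s) := by
    refine (dAux_wait _ f (τ.step a) b (consStep τ a m s)).trans ?_
    rw [headWait_eq_zero, map_zero]
    exact sub_zero _
  constructor
  · intro h
    refine ⟨funext fun σ => LinearMap.ext fun s => LinearMap.ext fun m => ?_, fun τ b m s => ?_⟩
    · have := hstep σ m s
      rw [h] at this
      exact neg_eq_zero.1 this.symm
    · have := hwait τ b m s
      rw [h] at this
      exact (sub_eq_zero.1 this.symm).symm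
  · rintro ⟨h, h'⟩
    funext σ
    cases σ with
    | wait τ =>
      cases τ with
      | wait τ => exact absurd τ.length_le (Nat.not_succ_le_self _)
      | step τ a =>
        refine ext_wait fun b s => ?_
        suffices H : Δ.d (ω.cons a) X (ω.length + 1) f (τ.step a).wait ∘ₗ consWait _ b = 0 from
          LinearMap.congr_fun H s
        refine ext_step fun m s => (hwait τ b m s).trans ?_
        rw [h', sub_self]
        rfl
    | step τ a =>
      refine ext_step fun m s => (hstep τ m s).trans ?_
      rw [h]
      exact neg_zero

/-- If `u` is universal along `ω` and `t` is the universal balanced map on `M_a × M`, then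
`m ⊗ s ↦ t(m, u(s))` is universal along `a ω`: a cocycle along `a ω` with coefficients in `X` is a
cocycle along `ω` with coefficients in `Hom_k(M_a, X)` that is linear over `A_{t(a)}`. -/
theorem IsUniversalCocycle.cons {u : Δ.Cochain ω M.carrier ω.length} (hu : IsUniversalCocycle u)
    (ht : IsBalancedTensor (Δ.M a) M T t) :
    IsUniversalCocycle (ω := ω.cons a) (M := T) (consCochain t u) where
  d_eq_zero := by
    refine (d_cons_eq_zero_iff _).2 ⟨funext fun σ => ?_, fun τ b m s => ht.map_left b m _⟩
    refine (dAux_comp (Algebra.lsmul k k M.carrier).toLinearMap (rhoStep T.carrier a) t.flip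
      (fun b p => LinearMap.ext fun m => ht.map_right b m p)
      (fun b p => LinearMap.ext fun m => (ht.balanced b m p).symm) u σ).trans ?_
    have h := congrFun hu.d_eq_zero σ
    exact (congrArg (t.flip ∘ₗ ·) h).trans (LinearMap.comp_zero _)
  exists_hom {X} f hf := by
    obtain ⟨h, h'⟩ := (d_cons_eq_zero_iff f).1 hf
    obtain ⟨φ, hφ, hφu⟩ := hu.exists_hom (X := homBimodule (Δ.M a) (Δ.A x) X.carrier)
      (headStep f) h
    change M.carrier →ₗ[k] (Δ.M a).carrier →ₗ[k] X.carrier at φ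
    -- `φ p` is `A_{t(a)}`-linear: the maps `p ↦ (m ↦ φ(p)(c m))` and `p ↦ (m ↦ c φ(p)(m))` agree on
    -- the universal cocycle.
    have hlin (c : Δ.A z) (m : (Δ.M a).carrier) (p : M.carrier) : φ p (c • m) = c • φ p m := by
      let ψ : M.carrier →ₗ[k] (Δ.M a).carrier →ₗ[k] X.carrier :=
        φ.compl₂ (Algebra.lsmul k k (Δ.M a).carrier c)
      let ψ' : M.carrier →ₗ[k] (Δ.M a).carrier →ₗ[k] X.carrier :=
        φ.compr₂ (Algebra.lsmul k k X.carrier c)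
      have hψ : IsHom (Y := homBimodule (Δ.M a) (Δ.A x) X.carrier) ψ :=
        ⟨fun b p => LinearMap.ext fun m => (LinearMap.congr_fun (hφ.map_left b p) (c • m)).trans
            (congrArg (φ p) (smul_comm c (op b) m).symm),
          fun a p => LinearMap.ext fun m => LinearMap.congr_fun (hφ.map_right a p) (c • m)⟩
      have hψ' : IsHom (Y := homBimodule (Δ.M a) (Δ.A x) X.carrier) ψ' :=
        ⟨fun b p => LinearMap.ext fun m =>
            congrArg (c • ·) (LinearMap.congr_fun (hφ.map_left b p) m),
          fun a p => LinearMap.ext fun m =>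
            (congrArg (c • ·) (LinearMap.congr_fun (hφ.map_right a p) m)).trans
              (smul_comm c a (φ p m))⟩
      have := hu.hom_ext hψ hψ' fun τ => LinearMap.ext fun s => LinearMap.ext fun m => by
        have hs : φ (u τ s) = headStep f τ s := LinearMap.congr_fun (hφu τ) s
        change φ (u τ s) (c • m) = c • φ (u τ s) m
        rw [hs]
        exact h' τ c m s
      exact LinearMap.congr_fun (LinearMap.congr_fun this p) m
    obtain ⟨Φ, hΦ⟩ := ht.exists_lift φ.flip fun b m p =>
      (LinearMap.congr_fun (hφ.map_left b p) m).symm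
    refine ⟨Φ, ⟨fun c p => ?_, fun b p => ?_⟩, fun τ => ?_⟩
    · suffices H : Φ ∘ₗ Algebra.lsmul k k T.carrier c = Algebra.lsmul k k X.carrier c ∘ₗ Φ from
        LinearMap.congr_fun H p
      refine ht.hom_ext fun m p => ?_
      change Φ (c • t m p) = c • Φ (t m p)
      rw [← ht.map_left, hΦ, hΦ]
      exact hlin c m p
    · suffices H : Φ ∘ₗ Algebra.lsmul k k T.carrier b = Algebra.lsmul k k X.carrier b ∘ₗ Φ from
        LinearMap.congr_fun H p
      refine ht.hom_ext fun m p => ?_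
      change Φ (b • t m p) = b • Φ (t m p)
      rw [← ht.map_right, hΦ, hΦ]
      exact LinearMap.congr_fun (hφ.map_right b p) m
    · cases τ with
      | wait τ => exact absurd τ.length_le (Nat.not_succ_le_self _)
      | step τ a =>
        exact ext_step fun m s => (hΦ m (u τ s)).trans
          (LinearMap.congr_fun (LinearMap.congr_fun (hφu τ) s) m)
  hom_ext {X φ ψ} hφ hψ h := by
    have hom {φ : T.carrier →ₗ[k] X.carrier} (hφ : IsHom φ) :
        IsHom (Y := homBimodule (Δ.M a) (Δ.A x) X.carrier) (t.compr₂ φ).flip :=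
      ⟨fun b p => LinearMap.ext fun m => congrArg φ (ht.balanced b m p).symm,
        fun b p => LinearMap.ext fun m =>
          (congrArg φ (ht.map_right b m p)).trans (hφ.map_right b _)⟩
    have := hu.hom_ext (hom hφ) (hom hψ) fun τ => LinearMap.ext fun s => LinearMap.ext fun m =>
      LinearMap.congr_fun (h (τ.step a)) (consStep τ a m s)
    exact ht.hom_ext fun m p => LinearMap.congr_fun (LinearMap.congr_fun this p) m

theorem exists_isBalancedTensor_pathBimodule (ω : Quiver.Path x y) (a : y ⟶ z) :
    ∃ t, IsBalancedTensor (Δ.M a) (Δ.pathBimodule ω) (Δ.pathBimodule (ω.cons a)) t := by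
  cases ω with
  | nil => exact ⟨_, isBalancedTensor_regular (Δ.M a)⟩
  | cons ω b => exact ⟨_, isBalancedTensor_tensor (Δ.M a) (Δ.pathBimodule (ω.cons b))⟩

theorem exists_isUniversalCocycle (ω : Quiver.Path x y) :
    ∃ u : Δ.Cochain ω (Δ.pathBimodule ω).carrier ω.length, IsUniversalCocycle u := by
  induction ω with
  | nil => exact ⟨_, isUniversalCocycle_unitCochain⟩
  | cons ω a ih =>
    obtain ⟨u, hu⟩ := ih
    obtain ⟨t, ht⟩ := exists_isBalancedTensor_pathBimodule (Δ := Δ) ω a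
    exact ⟨_, hu.cons ht⟩

end QSet

/-! ### `Ext` of bimodules -/

section Resolution

variable {k : Type u} [Field k] {S : Type u} [Ring S] [Algebra k S] {M : ModuleCat.{u} S}
  (P : ProjectiveResolution M)

/-- The functor `N ↦ Hom(P, N)` to complexes of vector spaces, for a projective resolution `P`. -/
def homFunctor (k : Type u) [Field k] [Algebra k S] (P : ProjectiveResolution M) :
    ModuleCat.{u} S ⥤ CochainComplex (ModuleCat.{u} k) ℕ where
  obj N := P.complex.linearYonedaObj k N
  map g :=
    { f := fun i => ModuleCat.ofHom (Linear.rightComp k (P.complex.X i) g)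
      comm' := fun i j _ => by
        ext : 1
        exact LinearMap.ext fun f => (Category.assoc _ f g).symm }
  map_id N := by
    ext i : 2
    exact LinearMap.ext fun f => Category.comp_id f
  map_comp g h := by
    ext i : 2
    exact LinearMap.ext fun f => (Category.assoc f g h).symm

instance : (homFunctor k P).PreservesZeroMorphisms where
  map_zero _ _ := by
    ext i : 2
    exact LinearMap.ext fun (f : P.complex.X i ⟶ _) => (Limits.comp_zero : f ≫ 0 = 0)

theorem homFunctor_shortExact (E : ShortComplex (ModuleCat.{u} S)) (hE : E.ShortExact) :
    (E.map (homFunctor k P)).ShortExact := by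
  have := hE.mono_f
  have := hE.epi_g
  refine HomologicalComplex.shortExact_of_degreewise_shortExact _ fun n => ?_
  refine ModuleCat.shortComplex_shortExact _ (fun f => ⟨fun h => ?_, ?_⟩) ?_ fun f => ?_
  · change P.complex.X n ⟶ E.X₂ at f
    exact ⟨hE.exact.lift f h, hE.exact.lift_f f h⟩
  · rintro ⟨g, rfl⟩
    change P.complex.X n ⟶ E.X₁ at g
    change (g ≫ E.f) ≫ E.g = 0
    rw [Category.assoc, E.zero, Limits.comp_zero]
  · intro f g h
    exact (cancel_mono E.f).1 h
  · change P.complex.X n ⟶ E.X₃ at f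
    exact ⟨Projective.factorThru f E.g, Projective.factorThru_comp f E.g⟩

theorem isZero_homology_homFunctor_iff (N : ModuleCat.{u} S) (n : ℕ) :
    Limits.IsZero (((homFunctor k P).obj N).homology (n + 1)) ↔
      ∀ f : P.complex.X (n + 1) ⟶ N, P.complex.d (n + 2) (n + 1) ≫ f = 0 →
        ∃ g : P.complex.X n ⟶ N, P.complex.d (n + 1) n ≫ g = f :=
  isZero_homology_succ_iff

/-- The augmentation of a projective resolution. -/
def augmentation : P.complex.X 0 ⟶ M :=
  P.π.f 0

/-- `Hom(M, N)` as the space of cocycles of degree zero in `Hom(P, N)`. -/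
def augmentationComp (k : Type u) [Field k] [Algebra k S] (P : ProjectiveResolution M)
    (N : ModuleCat.{u} S) : (M ⟶ N) →ₗ[k] ((homFunctor k P).obj N).X 0 :=
  Linear.leftComp k N (augmentation P)

theorem augmentationComp_injective (N : ModuleCat.{u} S) :
    Function.Injective (augmentationComp k P N) := by
  intro f g h
  have : Epi (augmentation P) := inferInstanceAs (Epi (P.π.f 0))
  exact (cancel_epi (augmentation P)).1 h

theorem mem_range_augmentationComp (N : ModuleCat.{u} S) (f : ((homFunctor k P).obj N).X 0) :
    (((homFunctor k P).obj N).d 0 1).hom f = 0 ↔ f ∈ LinearMap.range (augmentationComp k P N) := by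
  change P.complex.X 0 ⟶ N at f
  constructor
  · intro h
    have h : P.complex.d 1 0 ≫ f = 0 := h
    exact ⟨P.isColimitCokernelCofork.desc (Limits.CokernelCofork.ofπ f h),
      P.isColimitCokernelCofork.fac (Limits.CokernelCofork.ofπ f h)
        Limits.WalkingParallelPair.one⟩
  · rintro ⟨g, rfl⟩
    have h : P.complex.d 1 0 ≫ augmentation P = 0 := P.complex_d_comp_π_f_zero
    change P.complex.d 1 0 ≫ augmentation P ≫ g = 0
    rw [reassoc_of% h, Limits.zero_comp]

theorem linearMap_exists_comp_eq {E F X : Type*} [AddCommGroup E] [Module k E] [AddCommGroup F]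
    [Module k F] [AddCommGroup X] [Module k X] (g : E →ₗ[k] F) (f : E →ₗ[k] X)
    (h : LinearMap.ker g ≤ LinearMap.ker f) : ∃ f' : F →ₗ[k] X, f' ∘ₗ g = f := by
  obtain ⟨f', hf'⟩ := LinearMap.exists_extend
    ((LinearMap.ker g).liftQ f h ∘ₗ g.quotKerEquivRange.symm.toLinearMap)
  refine ⟨f', LinearMap.ext fun e => ?_⟩
  have h1 := LinearMap.congr_fun hf' (g.quotKerEquivRange (Submodule.Quotient.mk e))
  simp only [LinearMap.comp_apply, LinearEquiv.coe_coe, LinearEquiv.symm_apply_apply] at h1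
  exact h1

end Resolution

namespace KBimodule

variable {k : Type u} [Field k] {C B A : Type u} [Ring C] [Algebra k C] [Ring B] [Algebra k B]
  [Ring A] [Algebra k A] (N : KBimodule k C B) (M : KBimodule k B A)
  (P : ProjectiveResolution M.toModuleCat) (X : Type u) [AddCommGroup X] [Module k X]

/-- Vanishing of `Ext` with values in `Hom_k(N, Hom_k(A, X))`, expressed by the exactness of the
complex of balanced bilinear maps on `N × P` with values in `X`: a bimodule map
`P_i → Hom_k(N, Hom_k(A, X))` is determined by its evaluation at `1` in `A`. -/
theorem isZero_homology_coind (r : ℕ)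
    (h : ∀ φ : N.carrier →ₗ[k] (ofModule (P.complex.X (r + 1))).carrier →ₗ[k] X,
      (∀ (b : B) n p, φ (op b • n) p = φ n (b • p)) →
      (∀ n p, φ n (ofModuleMap (P.complex.d (r + 2) (r + 1)) p) = 0) →
      ∃ ψ : N.carrier →ₗ[k] (ofModule (P.complex.X r)).carrier →ₗ[k] X,
        (∀ (b : B) n p, ψ (op b • n) p = ψ n (b • p)) ∧
        ∀ n p, ψ n (ofModuleMap (P.complex.d (r + 1) r) p) = φ n p) :
    Limits.IsZero (((homFunctor k P).obj (coind N A X).toModuleCat).homology (r + 1)) := by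
  refine (isZero_homology_homFunctor_iff P _ r).2 fun f hf => ?_
  have he := isHom_toOfModule (coind N A X)
  let f' : (ofModule (P.complex.X (r + 1))).carrier →ₗ[k] N.carrier →ₗ[k] CoindRight k A X :=
    (coind N A X).toOfModule.symm.toLinearMap ∘ₗ ofModuleMap f
  have hf' : IsHom (Y := coind N A X) f' := he.symm.comp (isHom_ofModuleMap f)
  let ev : CoindRight k A X →ₗ[k] X := LinearMap.applyₗ (M := A) (M₂ := X) (1 : A)
  obtain ⟨ψ, hψ, hψf⟩ := h (f'.compr₂ ev).flip
    (fun b n p => congrArg ev (LinearMap.congr_fun (hf'.map_left b p) n).symm)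
    (fun n p => congrArg (fun q => ev ((show N.carrier →ₗ[k] CoindRight k A X from q) n))
      (LinearMap.congr_fun (congrArg ModuleCat.Hom.hom hf) p))
  -- The bimodule map `p ↦ (n ↦ (a ↦ ψ(n, p a)))`.
  let g' : (ofModule (P.complex.X r)).carrier →ₗ[k] N.carrier →ₗ[k] CoindRight k A X :=
    (LinearMap.mk₂ k (fun n p => ψ n ∘ₗ QSet.rightMul k A _ p)
      (fun n n' p => by rw [map_add, LinearMap.add_comp])
      (fun c n p => by rw [map_smul, LinearMap.smul_comp])
      (fun n p p' => by rw [map_add, LinearMap.comp_add])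
      (fun c n p => by rw [map_smul, LinearMap.comp_smul]) :
      N.carrier →ₗ[k] (ofModule (P.complex.X r)).carrier →ₗ[k] A →ₗ[k] X).flip
  have hg' : IsHom (Y := coind N A X) g' :=
    ⟨fun b p => LinearMap.ext fun n => LinearMap.ext fun (a : A) =>
      (congrArg (ψ n) (smul_comm b (op a) p).symm).trans (hψ b n (op a • p)).symm,
    fun a p => LinearMap.ext fun n => LinearMap.ext fun (a' : A) =>
      congrArg (ψ n) (mul_smul (op a') a p).symm⟩
  refine ⟨(he.comp hg').toModuleMap, ?_⟩
  ext p
  refine LinearMap.ext fun (n : N.carrier) => LinearMap.ext fun (a : A) => ?_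
  change (ofModule (P.complex.X (r + 1))).carrier at p
  change ψ n (op a • ofModuleMap (P.complex.d (r + 1) r) p) = (show A →ₗ[k] X from f' p n) a
  rw [← (isHom_ofModuleMap _).map_right, hψf]
  refine (congrArg ev (LinearMap.congr_fun (hf'.map_right (op a) p) n)).trans ?_
  exact congrArg (show A →ₗ[k] X from f' p n) (mul_one a)

/-- The higher `Ext` with values in `Hom_k(B, Hom_k(A, X))` vanish. -/
theorem isZero_homology_coind_regular (r : ℕ) : Limits.IsZero
    (((homFunctor k P).obj (coind (regular k B) A X).toModuleCat).homology (r + 1)) := by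
  refine isZero_homology_coind _ M P X r fun φ hφ hd => ?_
  change B →ₗ[k] (ofModule (P.complex.X (r + 1))).carrier →ₗ[k] X at φ
  -- A balanced map `φ` on `B × P_i` is determined by the linear map `φ(1, -)`, and `P` is exact.
  obtain ⟨ψ, hψ⟩ := linearMap_exists_comp_eq (ofModuleMap (P.complex.d (r + 1) r)) (φ 1) <| by
    intro p hp
    obtain ⟨q, rfl⟩ := (ShortComplex.moduleCat_exact_iff _).1 (P.exact_succ r) p hp
    exact hd (1 : B) q
  refine ⟨(Algebra.lsmul k k (A := B) (ofModule (P.complex.X r)).carrier).toLinearMap.compr₂ ψ,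
    fun b b' p => ?_, fun b p => ?_⟩
  · exact congrArg ψ (mul_smul (show B from b') b p)
  · have h (b : B) : ψ (b • ofModuleMap (P.complex.d (r + 1) r) p) = φ b p := by
      rw [← (isHom_ofModuleMap _).map_left]
      refine (LinearMap.congr_fun hψ (b • p)).trans ((hφ b (1 : B) p).symm.trans ?_)
      exact congrArg (φ · p) (one_mul b)
    exact h b

end KBimodule

/-! ### `Tor` and balanced bilinear maps -/

namespace KBimodule

variable {k : Type u} [Field k] {C B A : Type u} [Ring C] [Algebra k C] [Ring B] [Algebra k B]
  [Ring A] [Algebra k A]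

variable (k B A) in
/-- Restriction of scalars from `B ⊗ Aᵒᵖ` to `B`. -/
abbrev restrictLeft : ModuleCat.{u} (B ⊗[k] Aᵐᵒᵖ) ⥤ ModuleCat.{u} B :=
  ModuleCat.restrictScalars (Algebra.TensorProduct.includeLeft : B →ₐ[k] B ⊗[k] Aᵐᵒᵖ).toRingHom

/-- `B ⊗ Aᵒᵖ` is a free left `B`-module. -/
instance : Module.Free B ((restrictLeft k B A).obj (ModuleCat.of _ (B ⊗[k] Aᵐᵒᵖ))) :=
  let e : (B ⊗[k] Aᵐᵒᵖ) ≃ₗ[B] (restrictLeft k B A).obj (ModuleCat.of _ (B ⊗[k] Aᵐᵒᵖ)) :=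
    { toFun := fun s => s
      invFun := fun s => s
      left_inv := fun _ => rfl
      right_inv := fun _ => rfl
      map_add' := fun _ _ => rfl
      map_smul' := fun b s => by
        change b • s = (b ⊗ₜ[k] (1 : Aᵐᵒᵖ)) * s
        induction s with
        | zero => rw [smul_zero, mul_zero]
        | add s t hs ht => rw [smul_add, mul_add, hs, ht]
        | tmul b' a => rw [TensorProduct.smul_tmul', Algebra.TensorProduct.tmul_mul_tmul, one_mul,
            smul_eq_mul] }
  Module.Free.of_equiv e

instance : (restrictLeft k B A).PreservesHomology :=
  Functor.preservesHomology_of_map_exact _ fun S hS => by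
    rw [ShortComplex.ShortExact.moduleCat_exact_iff_function_exact] at hS ⊢
    exact hS

/-- Restriction of scalars preserves projectives, as its right adjoint `Hom_B(B ⊗ Aᵒᵖ, -)` is
exact. -/
instance : (restrictLeft k B A).PreservesProjectiveObjects := by
  have : (ModuleCat.coextendScalars
      (Algebra.TensorProduct.includeLeft : B →ₐ[k] B ⊗[k] Aᵐᵒᵖ).toRingHom).PreservesEpimorphisms :=
    ⟨fun {X Y} f hf => by
      rw [ModuleCat.epi_iff_surjective] at hf ⊢
      intro g
      exact Module.projective_lifting_property f.hom g hf⟩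
  exact Functor.preservesProjectiveObjects_of_adjunction_of_preservesEpimorphisms
    (ModuleCat.restrictCoextendScalarsAdj _)

/-- The left module underlying a bimodule. -/
def restrictLeftIso (M : KBimodule k B A) :
    (restrictLeft k B A).obj M.toModuleCat ≅ ModuleCat.of B M.carrier :=
  let e : (restrictLeft k B A).obj M.toModuleCat ≃ₗ[B] M.carrier :=
    { M.toOfModule.symm with
      map_smul' := fun b p => M.isHom_toOfModule.symm.map_left b p }
  e.toModuleIso

attribute [local instance] ModuleCat.moduleOfAlgebraModule
  ModuleCat.isScalarTower_of_algebra_moduleCat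

variable (N : KBimodule k C B) (M : KBimodule k B A) (P : ProjectiveResolution M.toModuleCat)

/-- If `Tor` vanishes in degree `r + 1`, then `N ⊗_B P` is exact there, since `P` is also a
projective resolution over `B`. -/
theorem exact_tensor_of_isZero_tor (r : ℕ)
    (h : Limits.IsZero (TorModule k B N.carrier M.carrier (r + 1))) :
    Function.Exact
      ((tensorFunctor k B N.carrier).map
        ((restrictLeft k B A).map (P.complex.d (r + 2) (r + 1)))).hom
      ((tensorFunctor k B N.carrier).map ((restrictLeft k B A).map (P.complex.d (r + 1) r))).hom := by
  let Q := (restrictLeft k B A).mapProjectiveResolution P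
  let K := ((tensorFunctor k B N.carrier).mapHomologicalComplex _).obj Q.complex
  have hK : Limits.IsZero (K.homology (r + 1)) :=
    (h.of_iso (((tensorFunctor k B N.carrier).leftDerived (r + 1)).mapIso
      M.restrictLeftIso)).of_iso (Q.isoLeftDerivedObj (tensorFunctor k B N.carrier) (r + 1)).symm
  rw [← K.exactAt_iff_isZero_homology,
    K.exactAt_iff' (r + 2) (r + 1) r (by simp) (by simp),
    ShortComplex.ShortExact.moduleCat_exact_iff_function_exact] at hK
  exact hK

/-- `Ext` with values in `Hom_k(N, Hom_k(A, X))` vanishes in the positive degrees in which `Tor`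
does. -/
theorem isZero_homology_coind_of_isZero_tor (X : Type u) [AddCommGroup X] [Module k X] (r : ℕ)
    (h : Limits.IsZero (TorModule k B N.carrier M.carrier (r + 1))) :
    Limits.IsZero (((homFunctor k P).obj (coind N A X).toModuleCat).homology (r + 1)) := by
  refine isZero_homology_coind N M P X r fun φ hφ hd => ?_
  have hex := exact_tensor_of_isZero_tor N M P r h
  -- The space of balanced bilinear maps on `N × P_i` is the dual of `N ⊗_B P_i`.
  let toRes (i : ℕ) : (ofModule (P.complex.X i)).carrier ≃ₗ[k]
      (restrictLeft k B A).obj (P.complex.X i) :=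
    { toFun := fun p => p
      invFun := fun p => p
      left_inv := fun _ => rfl
      right_inv := fun _ => rfl
      map_add' := fun _ _ => rfl
      map_smul' := fun _ _ => rfl }
  let d (i j : ℕ) := ((tensorFunctor k B N.carrier).map
    ((restrictLeft k B A).map (P.complex.d i j))).hom
  let φ' : BalTensor k B N.carrier ((restrictLeft k B A).obj (P.complex.X (r + 1))) →ₗ[k] X :=
    (balancedRel k B _ _).liftQ
      (TensorProduct.lift (φ.compl₂ (toRes (r + 1)).symm.toLinearMap)) <| by
        rw [balancedRel, Submodule.span_le]
        rintro _ ⟨n, b, p, rfl⟩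
        refine LinearMap.mem_ker.2 ?_
        rw [map_sub, sub_eq_zero]
        exact hφ b n p
  obtain ⟨ψ, hψ⟩ := linearMap_exists_comp_eq (d (r + 1) r) φ' <| by
    intro t ht
    obtain ⟨s, rfl⟩ := (hex t).1 ht
    suffices H : φ' ∘ₗ d (r + 2) (r + 1) = 0 from LinearMap.congr_fun H s
    exact BalTensor.ext k B fun n p => hd n p
  refine ⟨((TensorProduct.mk k N.carrier _).compr₂ (ψ ∘ₗ (balancedRel k B N.carrier
    ((restrictLeft k B A).obj (P.complex.X r))).mkQ)).compl₂ (toRes r).toLinearMap,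
    fun b n p => congrArg ψ ?_, fun n p => ?_⟩
  · refine (Submodule.Quotient.eq _).2 ?_
    exact Submodule.subset_span ⟨n, b, p, rfl⟩
  · exact LinearMap.congr_fun hψ (BalTensor.tmul k B n (toRes (r + 1) p))

theorem isZero_tor_regular (r : ℕ) :
    Limits.IsZero (TorModule k B N.carrier (regular k B).carrier (r + 1)) := by
  have : Projective (ModuleCat.of B (regular k B).carrier) :=
    inferInstanceAs (Projective (ModuleCat.of B B))
  exact (tensorFunctor k B N.carrier).isZero_leftDerived_obj_projective_succ r _

end KBimodule

/-! ### Cohomology along a path -/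

namespace QSet

variable {k : Type u} [Field k] {V : Type w} [Quiver.{v} V] {Δ : QSet k V} {x y z : V}

open KBimodule

/-- There are no trajectories over `ω` of duration less than the length of `ω`, hence no
coboundaries in degree `ω.length`. -/
theorem complex_d_length (ω : Quiver.Path x y) (X : KBimodule k (Δ.A y) (Δ.A x)) (i : ℕ) :
    (Δ.complex ω X).d i ω.length = 0 := by
  by_cases h : i + 1 = ω.length
  · ext : 1
    refine LinearMap.ext fun f => ?_
    have hf : f = 0 := funext fun τ : Traj ω i => absurd τ.length_le (by omega)
    rw [hf, map_zero, map_zero]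
  · exact (Δ.complex ω X).shape _ _ h

/-- Composition of a cochain `u` with maps of bimodules. -/
def compCochain {ω : Quiver.Path x y} {M : KBimodule k (Δ.A y) (Δ.A x)} {n : ℕ}
    (u : Δ.Cochain ω M.carrier n) (N : ModuleCat.{u} (Δ.A y ⊗[k] (Δ.A x)ᵐᵒᵖ)) :
    (M.toModuleCat ⟶ N) →ₗ[k] Δ.Cochain ω (ofModule N).carrier n where
  toFun φ τ := ofModuleMap φ ∘ₗ M.toOfModule.toLinearMap ∘ₗ u τ
  map_add' _ _ := rfl
  map_smul' _ _ := rfl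

section UniversalCocycle

variable {ω : Quiver.Path x y} {M : KBimodule k (Δ.A y) (Δ.A x)}
  {u : Δ.Cochain ω M.carrier ω.length}

theorem IsUniversalCocycle.compCochain_injective (hu : IsUniversalCocycle u)
    (N : ModuleCat.{u} (Δ.A y ⊗[k] (Δ.A x)ᵐᵒᵖ)) : Function.Injective (compCochain u N) := by
  intro φ ψ h
  have := hu.hom_ext (X := ofModule N) ((isHom_ofModuleMap φ).comp M.isHom_toOfModule)
    ((isHom_ofModuleMap ψ).comp M.isHom_toOfModule) fun τ => congrFun h τ
  ext p
  exact LinearMap.congr_fun this p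

theorem IsUniversalCocycle.mem_range_compCochain (hu : IsUniversalCocycle u)
    (N : ModuleCat.{u} (Δ.A y ⊗[k] (Δ.A x)ᵐᵒᵖ)) (f : Δ.Cochain ω (ofModule N).carrier ω.length) :
    Δ.d ω (ofModule N) ω.length f = 0 ↔ f ∈ LinearMap.range (compCochain u N) := by
  constructor
  · intro hf
    obtain ⟨φ, hφ, h⟩ := hu.exists_hom f hf
    exact ⟨(hφ.comp M.isHom_toOfModule.symm).toModuleMap, funext h⟩
  · rintro ⟨φ, rfl⟩
    refine (d_comp_apply ((isHom_ofModuleMap φ).comp M.isHom_toOfModule) u).trans ?_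
    rw [hu.d_eq_zero]
    exact funext fun τ => LinearMap.comp_zero _

end UniversalCocycle

/-- Cohomology along `ω` is `Ext` of the bimodule `M_ω` as soon as it vanishes above the lowest
degree for coinduced coefficients. -/
theorem nonempty_homology_complex_equiv (ω : Quiver.Path x y)
    (P : ProjectiveResolution (Δ.pathBimodule ω).toModuleCat)
    (hω : ∀ (X : Type u) [AddCommGroup X] [Module k X] (n : ℕ), ω.length < n →
      Limits.IsZero ((Δ.complex ω (coind (regular k (Δ.A y)) (Δ.A x) X)).homology n))
    (X : KBimodule k (Δ.A y) (Δ.A x)) (r : ℕ) :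
    Nonempty ((Δ.complex ω X).homology (ω.length + r) ≃ₗ[k]
      ((homFunctor k P).obj X.toModuleCat).homology r) := by
  obtain ⟨u, hu⟩ := exists_isUniversalCocycle (Δ := Δ) ω
  have hF (N : ModuleCat.{u} (Δ.A y ⊗[k] (Δ.A x)ᵐᵒᵖ)) := 
    exists_homology_equiv (K := (Δ.complexFunctor ω).obj N)
    (complex_d_length ω (ofModule N)) (compCochain u N) (hu.compCochain_injective N) fun f => by
      refine (iff_of_eq (congrArg (fun d => ModuleCat.Hom.hom d f = 0)
        (complex_d (ofModule N) ω.length))).trans ?_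
      exact hu.mem_range_compCochain N f
  have hG₀ (N : ModuleCat.{u} (Δ.A y ⊗[k] (Δ.A x)ᵐᵒᵖ)) (i : ℕ) :
      ((homFunctor k P).obj N).d i 0 = 0 := ((homFunctor k P).obj N).shape _ _ (Nat.succ_ne_zero i)
  have hG (N : ModuleCat.{u} (Δ.A y ⊗[k] (Δ.A x)ᵐᵒᵖ)) := exists_homology_equiv
    (hG₀ N) (augmentationComp k P N) (augmentationComp_injective P N)
      (mem_range_augmentationComp P N)
  choose e he using hF
  choose e' he' using hG
  obtain ⟨a⟩ := nonempty_homology_equiv_of_effaceable (Δ.complexFunctor ω) (homFunctor k P)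
    (complexFunctor_shortExact ω) (homFunctor_shortExact P) ω.length 0
    (fun N => (e N).trans (e' N).symm) (fun {N N'} f h => by
      refine (e' N').injective ?_
      rw [LinearEquiv.trans_apply, LinearEquiv.apply_symm_apply]
      refine (homology_equiv_naturality _ _ ((Δ.complexFunctor ω).map f)
        (hu.compCochain_injective N') (he N) (he N') (· ≫ f) (fun _ => rfl) h).trans ?_
      refine Eq.trans ?_ (homology_equiv_naturality _ _ ((homFunctor k P).map f)
        (augmentationComp_injective P N') (he' N) (he' N') (· ≫ f)
        (fun φ => (Category.assoc _ φ f).symm) _).symm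
      rw [LinearEquiv.trans_apply, LinearEquiv.apply_symm_apply])
    (fun N => by
      let i := ((isHom_toOfModule _).comp (isHom_toCoind (ofModule N))).toModuleMap
      refine ⟨(coind (regular k (Δ.A y)) (Δ.A x) (ofModule N).carrier).toModuleCat, i, ?_,
        fun r hr => ⟨?_, ?_⟩⟩
      · rw [ModuleCat.mono_iff_injective]
        exact toCoind_injective (ofModule N)
      · refine (hω (ofModule N).carrier (ω.length + r) (by omega)).of_iso ?_
        exact (HomologicalComplex.homologyFunctor _ _ _).mapIso
          (complexIso ω (isHom_toOfModule _)).symm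
      · obtain ⟨r, rfl⟩ := Nat.exists_eq_succ_of_ne_zero hr.ne'
        rw [Nat.zero_add]
        exact isZero_homology_coind_regular _ P _ r)
    r X.toModuleCat
  rw [Nat.zero_add] at a
  exact ⟨((HomologicalComplex.homologyFunctor _ _ _).mapIso
    (complexIso ω X.isHom_toOfModule)).toLinearEquiv.trans a⟩

theorem TorVanishing.cons {ω : Quiver.Path x y} {a : y ⟶ z} (h : Δ.TorVanishing (ω.cons a)) :
    Δ.TorVanishing ω ∧ ∀ n, 0 < n → Limits.IsZero
      (TorModule k (Δ.A y) (Δ.M a).carrier (Δ.pathBimodule ω).carrier n) := by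
  cases ω with
  | nil =>
    refine ⟨trivial, fun n hn => ?_⟩
    obtain ⟨n, rfl⟩ := Nat.exists_eq_succ_of_ne_zero hn.ne'
    exact isZero_tor_regular (Δ.M a) n
  | cons ω b => exact h

/-- Along a Tor-vanishing path, the cohomology with coefficients in a coinduced bimodule vanishes
above the lowest degree. For the path `a ω` it is controlled by the cohomology along `ω` with
coefficients in `Hom_k(M_a, Hom_k(A_{s(ω)}, X))`, that is, by the dual of `Tor(M_a, M_ω)`. -/
theorem isZero_homology_complex_coind (ω : Quiver.Path x y) (h : Δ.TorVanishing ω) (X : Type u)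
    [AddCommGroup X] [Module k X] (n : ℕ) (hn : ω.length < n) :
    Limits.IsZero ((Δ.complex ω (coind (regular k (Δ.A y)) (Δ.A x) X)).homology n) := by
  induction ω generalizing X n with
  | nil =>
    obtain ⟨n, rfl⟩ := Nat.exists_eq_succ_of_ne_zero (Nat.ne_zero_of_lt hn)
    exact (isZero_homology_complex_iff _ n).2 exists_dAux_eq_nil
  | @cons y z ω a ih =>
    obtain ⟨n, rfl⟩ : ∃ m, n = m + 2 := ⟨n - 2, by rw [Quiver.Path.length_cons] at hn; omega⟩
    refine (isZero_homology_complex_iff _ (n + 1)).2 (exists_dAux_eq_cons ?_)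
    obtain ⟨hω, htor⟩ := h.cons
    have hn : ω.length < n + 1 := by rw [Quiver.Path.length_cons] at hn; omega
    refine (isZero_homology_complex_iff (coind (Δ.M a) (Δ.A x) X) n).1 ?_
    obtain ⟨r, hr⟩ := Nat.exists_eq_add_of_lt hn
    let P := projectiveResolution (Δ.pathBimodule ω).toModuleCat
    obtain ⟨e⟩ := nonempty_homology_complex_equiv ω P (fun X _ _ => ih hω X)
      (coind (Δ.M a) (Δ.A x) X) (r + 1)
    rw [hr]
    have := ModuleCat.subsingleton_of_isZero
      (isZero_homology_coind_of_isZero_tor _ _ P X r (htor (r + 1) r.succ_pos))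
    have := e.toEquiv.subsingleton
    exact ModuleCat.isZero_of_subsingleton _

end QSet

end PathCohomology

end

theorem mainTheorem3 {k : Type u} [Field k] {V : Type w} [Quiver.{v} V]
    (hQ : PathCohomology.IsSimplyLaced V) (Δ : PathCohomology.QSet k V)
    {x y : V} (ω : Quiver.Path x y) (hω : 2 ≤ ω.length) (htor : Δ.TorVanishing ω) (r : ℕ) :
    Nonempty (Δ.cohomology ω (ω.length + r) ≃ₗ[k]
      ((Ext k (ModuleCat.{u} (Δ.A y ⊗[k] (Δ.A x)ᵐᵒᵖ)) r).obj
        (Opposite.op (Δ.pathBimodule ω).toModuleCat)).obj (Δ.hom x y).toModuleCat) := by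
  let P := projectiveResolution (Δ.pathBimodule ω).toModuleCat
  obtain ⟨e⟩ := PathCohomology.QSet.nonempty_homology_complex_equiv ω P
    (fun X _ _ => PathCohomology.QSet.isZero_homology_complex_coind ω htor X) (Δ.hom x y) r
  exact ⟨e.trans (P.isoExt r (Δ.hom x y).toModuleCat).symm.toLinearEquiv⟩
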